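/- Let $L,\rho_1,\rho_2,\rho_3,b,k,\gamma,\kappa,\delta,\tau_0,\mu$ be positive constants. Consider on $(0,\infty)\times(0,L)$ the system \begin{align*} &\rho_1\varphi_{tt}-k(\varphi_x+\psi)_x+\mu\varphi_t=0,\\ &\rho_2\psi_{tt}-b\psi_{xx}+k(\varphi_x+\psi)+\gamma\theta_x=0,\\ &\rho_3\theta_t+\kappa q_x+\gamma\psi_{tx}=0,\\ &\tau_0q_t+\delta q+\kappa\theta_x=0, \end{align*} with boundary conditions $\varphi=\psi=q=0$ at $x=0$ and $x=L$ and initial conditions $\varphi(0)=\varphi_0$, $\varphi_t(0)=\varphi_1$, $\psi(0)=\psi_0$, $\psi_t(0)=\psi_1$, $\theta(0)=\theta_0$, $q(0)=q_0$. With $V=(\varphi,\varphi_t,\psi,\psi_t,\theta,q)$ write the problem as $V_t=AV$, $V(0)=V_0$, in $\mathcal H=H^1_0\times L^2\times H^1_0\times L^2\times L^2\times L^2$ (all spaces over $(0,L)$), where $D(A)=\{V\in\mathcal H:\ \varphi,\psi\in H^2\cap H^1_0,\ \varphi_t,\psi_t,q\in H^1_0,\ \theta\in H^1\}$. Let $$E(t;\varphi,\psi,\theta,q)=\tfrac12\int_0^L\bigl(\rho_1\varphi_t^2+\rho_2\psi_t^2+b\psi_x^2+k(\varphi_x+\psi)^2+\rho_3\theta^2+\tau_0q^2\bigr)\,dx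 .$$ Then there exist constants $C>0$ and $\alpha>0$, independent of $t$ and of the initial data, such that every solution satisfies $$E(t;\varphi,\psi,\bar\theta,q)\le C\,E(0;\varphi,\psi,\bar\theta,q)\,e^{-2\alpha t}\qquad\text{for all }t\ge0,\qquad \bar\theta(t,x)=\theta(t,x)-\frac1L\int_0^L\theta_0(s)\,ds .$$ This holds for classical solutions, $V\in C^1([0,\infty),\mathcal H)\cap C^0([0,\infty),D(A))$ with $V_t=AV$ (data $V_0\in D(A)$), and, with the same constants, for mild solutions, $V\in C^0([0,\infty),\mathcal H)$ with $\int_0^tV(s)\,ds\in D(A)$ and $V(t)=V_0+A\int_0^tV(s)\,ds$ for all $t\ge0$ (data $V_0\in\mathcal H$). No relation between the coefficients, in particular between the wave speeds $k/\rho_1$ and $b/\rho_2$, is assumed. -/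

import Mathlib

open MeasureTheory Set
open scoped ContDiff

noncomputable section

namespace Timoshenko

/-- The Hilbert space `L²((0, L))` of real functions. -/
abbrev L2 (L : ℝ) : Type := Lp ℝ 2 (volume.restrict (Ioo 0 L))

/-- Test functions on `(0, L)`: smooth, with compact support contained in `(0, L)`. -/
def IsTestFunction (L : ℝ) (η : ℝ → ℝ) : Prop :=
  ContDiff ℝ ∞ η ∧ HasCompactSupport η ∧ tsupport η ⊆ Ioo 0 L

/-- `v ∈ L²((0, L))` is the weak derivative of `u ∈ L²((0, L))`; in particular
`u ∈ H¹((0, L))`, and `H¹((0, L))` consists of those `u` that have such a `v`. -/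
def HasWeakDeriv (L : ℝ) (u v : L2 L) : Prop :=
  ∀ η : ℝ → ℝ, IsTestFunction L η →
    ∫ x in Ioo 0 L, u x * deriv η x = -∫ x in Ioo 0 L, v x * η x

/-- The pairs `(η, η')` in `L² × L²`, for test functions `η` on `(0, L)`. -/
def testGraph (L : ℝ) : Submodule ℝ (L2 L × L2 L) where
  carrier := {p | ∃ η : ℝ → ℝ, IsTestFunction L η ∧
    p.1 =ᵐ[volume.restrict (Ioo 0 L)] η ∧ p.2 =ᵐ[volume.restrict (Ioo 0 L)] deriv η}
  zero_mem' := by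
    refine ⟨0, ⟨contDiff_const, HasCompactSupport.zero, by simp [tsupport]⟩,
      Lp.coeFn_zero _ _ _, ?_⟩
    have h : deriv (0 : ℝ → ℝ) = 0 := by
      funext x
      simp
    rw [h]
    exact Lp.coeFn_zero _ _ _
  add_mem' := by
    rintro p p' ⟨η, ⟨h1, h2, h3⟩, h4, h5⟩ ⟨ξ, ⟨g1, g2, g3⟩, g4, g5⟩
    refine ⟨η + ξ, ⟨h1.add g1, h2.add g2, (tsupport_add η ξ).trans (union_subset h3 g3)⟩,
      (Lp.coeFn_add _ _).trans (h4.add g4), ?_⟩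
    have h : deriv (η + ξ) = deriv η + deriv ξ := by
      funext x
      exact deriv_add (h1.differentiable (by simp) x) (g1.differentiable (by simp) x)
    rw [h]
    exact (Lp.coeFn_add _ _).trans (h5.add g5)
  smul_mem' := by
    rintro c p ⟨η, ⟨h1, h2, h3⟩, h4, h5⟩
    refine ⟨c • η, ⟨contDiff_const.smul h1, h2.smul_left, ?_⟩,
      (Lp.coeFn_smul _ _).trans (h4.const_smul c), ?_⟩
    · exact (closure_mono (Function.support_const_smul_subset c η)).trans h3
    · have h : deriv (c • η) = c • deriv η := by
        funext x
        exact deriv_const_smul c (h1.differentiable (by simp) x)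
      rw [h]
      exact (Lp.coeFn_smul _ _).trans (h5.const_smul c)

/-- The Sobolev space `H¹₀((0, L))`, the closure of the test functions in the `H¹` norm.
An element is stored as the pair `(u, uₓ)` of a function and its weak derivative. -/
abbrev H10 (L : ℝ) : Submodule ℝ (L2 L × L2 L) := (testGraph L).topologicalClosure

/-- The energy space `H¹₀ × L² × H¹₀ × L² × L² × L²`; its elements are the states
`(φ, φₜ, ψ, ψₜ, θ, q)`. -/
abbrev State (L : ℝ) : Type := H10 L × L2 L × H10 L × L2 L × L2 L × L2 L

namespace State

variable {L : ℝ}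

/-- First component, `φ`. -/
def φ (V : State L) : L2 L := V.1.1.1
/-- The weak derivative `φₓ` of the first component. -/
def φx (V : State L) : L2 L := V.1.1.2
/-- Second component, `φₜ`. -/
def φt (V : State L) : L2 L := V.2.1
/-- Third component, `ψ`. -/
def ψ (V : State L) : L2 L := V.2.2.1.1.1
/-- The weak derivative `ψₓ` of the third component. -/
def ψx (V : State L) : L2 L := V.2.2.1.1.2
/-- Fourth component, `ψₜ`. -/
def ψt (V : State L) : L2 L := V.2.2.2.1
/-- Fifth component, `θ`. -/
def θ (V : State L) : L2 L := V.2.2.2.2.1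
/-- Sixth component, `q`. -/
def q (V : State L) : L2 L := V.2.2.2.2.2

end State

/-- The length of the beam and the coefficients of the system. -/
structure Params where
  L : ℝ
  ρ₁ : ℝ
  ρ₂ : ℝ
  ρ₃ : ℝ
  b : ℝ
  k : ℝ
  γ : ℝ
  κ : ℝ
  δ : ℝ
  τ₀ : ℝ
  μ : ℝ

/-- `V` lies in the domain `D(A)` of the generator and `A V = W`. Here
`D(A)` consists of the states `V` with `φ, ψ ∈ H² ∩ H¹₀`, `φₜ, ψₜ, q ∈ H¹₀` and `θ ∈ H¹`,
and `W` stands for the time derivative `Vₜ = (φₜ, φₜₜ, ψₜ, ψₜₜ, θₜ, qₜ)`. -/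
def GeneratorRel (p : Params) (V W : State p.L) : Prop :=
  ∃ (φxx ψxx φtx ψtx θx qx : L2 p.L)
    (hφt : (V.φt, φtx) ∈ H10 p.L) (hψt : (V.ψt, ψtx) ∈ H10 p.L),
    (V.q, qx) ∈ H10 p.L ∧
    HasWeakDeriv p.L V.φx φxx ∧ HasWeakDeriv p.L V.ψx ψxx ∧ HasWeakDeriv p.L V.θ θx ∧
    W.1 = ⟨(V.φt, φtx), hφt⟩ ∧
    p.ρ₁ • W.φt - p.k • (φxx + V.ψx) + p.μ • V.φt = 0 ∧
    W.2.2.1 = ⟨(V.ψt, ψtx), hψt⟩ ∧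
    p.ρ₂ • W.ψt - p.b • ψxx + p.k • (V.φx + V.ψ) + p.γ • θx = 0 ∧
    p.ρ₃ • W.θ + p.κ • qx + p.γ • ψtx = 0 ∧
    p.τ₀ • W.q + p.δ • V.q + p.κ • θx = 0

/-- Classical solutions of the initial boundary value problem:
`V ∈ C¹([0, ∞), H) ∩ C⁰([0, ∞), D(A))` and `Vₜ = A V`. The initial datum is `V 0`;
values at negative times are irrelevant. -/
def IsClassicalSolution (p : Params) (V : ℝ → State p.L) : Prop :=
  ∃ W : ℝ → State p.L, ContinuousOn W (Ici 0) ∧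
    ∀ t : ℝ, 0 ≤ t → HasDerivWithinAt V (W t) (Ici 0) t ∧ GeneratorRel p (V t) (W t)

/-- Mild solutions: `V ∈ C⁰([0, ∞), H)` and `V(t) = V(0) + A ∫₀ᵗ V(s) ds` for all `t ≥ 0`.
The initial datum `V 0` may be any element of the energy space. -/
def IsMildSolution (p : Params) (V : ℝ → State p.L) : Prop :=
  ContinuousOn V (Ici 0) ∧
    ∀ t : ℝ, 0 ≤ t → GeneratorRel p (∫ s in (0 : ℝ)..t, V s) (V t - V 0)

/-- The energy `½ ∫₀ᴸ (ρ₁φₜ² + ρ₂ψₜ² + bψₓ² + k(φₓ + ψ)² + ρ₃ϑ² + τ₀q²) dx` of a state, with a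
function `ϑ` in place of its temperature component. -/
def energy (p : Params) (V : State p.L) (ϑ : ℝ → ℝ) : ℝ :=
  1 / 2 * ∫ x in Ioo 0 p.L,
    (p.ρ₁ * V.φt x ^ 2 + p.ρ₂ * V.ψt x ^ 2 + p.b * V.ψx x ^ 2
      + p.k * (V.φx x + V.ψ x) ^ 2 + p.ρ₃ * ϑ x ^ 2 + p.τ₀ * V.q x ^ 2)

/-- The mean-corrected temperature `θ̄(t, x) = θ(t, x) - (1/L) ∫₀ᴸ θ₀(s) ds`. -/
def thetaBar (p : Params) (V : ℝ → State p.L) (t x : ℝ) : ℝ :=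
  (V t).θ x - 1 / p.L * ∫ s in Ioo 0 p.L, (V 0).θ s

/-- `E(t; φ, ψ, θ̄, q)`. -/
def E (p : Params) (V : ℝ → State p.L) (t : ℝ) : ℝ :=
  energy p (V t) (thetaBar p V t)

end Timoshenko

end

/-!
The energy decays because it is equivalent to a Lyapunov functional. For a classical solution the
energy `E` satisfies `E' = -μ ‖φₜ‖² - δ ‖q‖²` (`hasDerivWithinAt_normEnergy`), so damping acts on
`φₜ` and `q` only. The mean of `θ` is conserved, hence `θ̄` is the mean-free part of `θ(t)` and has
a primitive `Θ = J θ` in `H¹₀`. Three multipliers transfer the dissipation to the other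
components, up to cross terms handled by Young's inequality:

* `-τ₀ ⟪q, Θ⟫` yields `-κ ‖θ̄‖²`, by Cattaneo's law (`hasDerivWithinAt_inner_q`);
* `ρ₂ ρ₃ ⟪Θ, ψₜ⟫` yields `-γ ρ₂ ‖ψₜ‖²`, by the integrated heat balance
  `ρ₃ Θₜ = -(κ q + γ ψₜ)` (`hasDerivWithinAt_inner_ψt`);
* `ρ₂ ⟪ψₜ, ψ⟫ + ρ₁ ⟪φₜ, φ⟫ + μ/2 ‖φ‖²` yields `-b ‖ψₓ‖² - k ‖φₓ + ψ‖²`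
  (`hasDerivWithinAt_inner_φ_ψ`).

Since `φₜ` is damped directly, the elastic energy is recovered without a multiplier that mixes the
two wave equations, and the wave speeds never have to be compared. Fixing the weights from the
last multiplier to the first, and the weight of `E` at the end (`exists_weights`), gives a
functional `F`, comparable to `E`, with `F' ≤ -E / 2`, and Grönwall's inequality concludes.

The operator `J` exists because the derivatives of `H¹₀` functions fill the space of mean-free
functions (`exists_mem_H10_of_inner_one_eq_zero`): their range is closed by the Poincaré
inequality, and its orthogonal complement is the constants by du Bois-Reymond's lemma.

Mild solutions need no semigroup theory. If `U` is the primitive of a mild solution `V`, the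
averages `(U(t + h) - U(t)) / h` are classical solutions (`isClassicalSolution_average`) and tend to
`V(t)` as `h → 0⁺`; the energy is continuous, so the estimate passes to the limit.
-/

noncomputable section

namespace Timoshenko

variable {L : ℝ}

/-! ### The Sobolev spaces on an interval -/

lemma inner_eq_setIntegral (u v : L2 L) : inner ℝ u v = ∫ x in Ioo 0 L, u x * v x := by
  rw [L2.inner_def]
  refine integral_congr_ae (Filter.Eventually.of_forall fun x => ?_)
  simp [mul_comm]

lemma norm_sq_eq_setIntegral (u : L2 L) : ‖u‖ ^ 2 = ∫ x in Ioo 0 L, u x ^ 2 := by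
  rw [← real_inner_self_eq_norm_sq, inner_eq_setIntegral]
  simp [sq]

/-- The constant function `1` in `L²((0, L))`. -/
def one (L : ℝ) : L2 L := Lp.const 2 _ (1 : ℝ)

lemma coeFn_one : one L =ᵐ[volume.restrict (Ioo 0 L)] fun _ => (1 : ℝ) :=
  Lp.coeFn_const _ _ _

lemma inner_one_left (u : L2 L) : inner ℝ (one L) u = ∫ x in Ioo 0 L, u x := by
  rw [inner_eq_setIntegral]
  refine integral_congr_ae ?_
  filter_upwards [coeFn_one (L := L)] with x hx
  simp [hx]

lemma inner_one_one (hL : 0 ≤ L) : inner ℝ (one L) (one L) = L := by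
  rw [inner_one_left, integral_congr_ae coeFn_one]
  simp [hL]

namespace IsTestFunction

variable {η : ℝ → ℝ}

lemma apply_zero (h : IsTestFunction L η) : η 0 = 0 :=
  image_eq_zero_of_notMem_tsupport fun h0 => lt_irrefl _ (h.2.2 h0).1

lemma apply_right (h : IsTestFunction L η) : η L = 0 :=
  image_eq_zero_of_notMem_tsupport fun h0 => lt_irrefl _ (h.2.2 h0).2

lemma contDiff_deriv (h : IsTestFunction L η) : ContDiff ℝ ∞ (deriv η) :=
  (contDiff_infty_iff_deriv.1 h.1).2

lemma differentiable (h : IsTestFunction L η) : Differentiable ℝ η :=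
  h.1.differentiable (by simp)

lemma exists_mem_testGraph (h : IsTestFunction L η) :
    ∃ p ∈ testGraph L, p.1 =ᵐ[volume.restrict (Ioo 0 L)] η ∧
      p.2 =ᵐ[volume.restrict (Ioo 0 L)] deriv η := by
  have h1 : MemLp η 2 (volume.restrict (Ioo 0 L)) :=
    (h.1.continuous.memLp_of_hasCompactSupport h.2.1).restrict _
  have h2 : MemLp (deriv η) 2 (volume.restrict (Ioo 0 L)) :=
    (h.contDiff_deriv.continuous.memLp_of_hasCompactSupport h.2.1.deriv).restrict _
  exact ⟨(h1.toLp η, h2.toLp _), ⟨η, h, h1.coeFn_toLp, h2.coeFn_toLp⟩,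
    h1.coeFn_toLp, h2.coeFn_toLp⟩

end IsTestFunction

lemma setIntegral_deriv_eq_zero (hL : 0 ≤ L) {f : ℝ → ℝ} (hf : ContDiff ℝ 1 f)
    (h0 : f 0 = 0) (h1 : f L = 0) : ∫ x in Ioo 0 L, deriv f x = 0 := by
  rw [← integral_Ioc_eq_integral_Ioo, ← intervalIntegral.integral_of_le hL,
    intervalIntegral.integral_eq_sub_of_hasDerivAt
      (fun x _ => (hf.differentiable (by simp) x).hasDerivAt)
      ((hf.continuous_deriv le_rfl).intervalIntegrable _ _), h0, h1, sub_zero]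

lemma integrable_restrict_Ioo {f : ℝ → ℝ} (hf : Continuous f) :
    Integrable f (volume.restrict (Ioo 0 L)) :=
  (hf.integrableOn_Icc (a := 0) (b := L)).mono_set Ioo_subset_Icc_self

/-- Integration by parts against elements of `H¹₀`; the boundary terms vanish. -/
lemma HasWeakDeriv.inner_eq {u v : L2 L} (h : HasWeakDeriv L u v) {w wx : L2 L}
    (hw : (w, wx) ∈ H10 L) : inner ℝ u wx = -inner ℝ v w := by
  have key : ∀ p ∈ H10 L, inner ℝ u p.2 = -inner ℝ v p.1 := by
    intro p hp
    have hc : IsClosed {p : L2 L × L2 L | inner ℝ u p.2 = -inner ℝ v p.1} :=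
      isClosed_eq (by fun_prop) (by fun_prop)
    refine (hc.closure_subset_iff.2 ?_) hp
    rintro p ⟨η, hη, h1, h2⟩
    have := h η hη
    simp only [mem_ofPred_eq, inner_eq_setIntegral]
    convert this using 1
    · refine integral_congr_ae ?_
      filter_upwards [h2] with x hx
      rw [hx]
    · congr 1
      refine integral_congr_ae ?_
      filter_upwards [h1] with x hx
      rw [hx]
  exact key _ hw

lemma hasWeakDeriv_of_forall_inner {u v : L2 L}
    (h : ∀ p ∈ testGraph L, inner ℝ u p.2 = -inner ℝ v p.1) : HasWeakDeriv L u v := by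
  intro η hη
  obtain ⟨p, hp, h1, h2⟩ := hη.exists_mem_testGraph
  have := h p hp
  simp only [inner_eq_setIntegral] at this
  convert this using 1
  · refine integral_congr_ae ?_
    filter_upwards [h2] with x hx
    rw [hx]
  · congr 1
    refine integral_congr_ae ?_
    filter_upwards [h1] with x hx
    rw [hx]

lemma HasWeakDeriv.add {u v u' v' : L2 L} (h : HasWeakDeriv L u v) (h' : HasWeakDeriv L u' v') :
    HasWeakDeriv L (u + u') (v + v') :=
  hasWeakDeriv_of_forall_inner fun p hp => by
    have hp' : (p.1, p.2) ∈ H10 L := (testGraph L).le_topologicalClosure hp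
    rw [inner_add_left, inner_add_left, h.inner_eq hp', h'.inner_eq hp']
    ring

lemma HasWeakDeriv.smul {u v : L2 L} (h : HasWeakDeriv L u v) (c : ℝ) :
    HasWeakDeriv L (c • u) (c • v) :=
  hasWeakDeriv_of_forall_inner fun p hp => by
    have hp' : (p.1, p.2) ∈ H10 L := (testGraph L).le_topologicalClosure hp
    rw [real_inner_smul_left, real_inner_smul_left, h.inner_eq hp']
    ring

lemma hasWeakDeriv_one (hL : 0 ≤ L) : HasWeakDeriv L (one L) 0 := by
  refine hasWeakDeriv_of_forall_inner ?_
  rintro p ⟨η, hη, h1, h2⟩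
  rw [inner_one_left, integral_congr_ae h2, inner_zero_left, neg_zero]
  exact setIntegral_deriv_eq_zero hL (hη.1.of_le (by simp)) hη.apply_zero hη.apply_right

lemma hasWeakDeriv_of_mem_H10 (hL : 0 ≤ L) {u ux : L2 L} (hu : (u, ux) ∈ H10 L) :
    HasWeakDeriv L u ux := by
  refine hasWeakDeriv_of_forall_inner fun p hp => ?_
  have hc : IsClosed {w : L2 L × L2 L | inner ℝ w.1 p.2 = -inner ℝ w.2 p.1} :=
    isClosed_eq (by fun_prop) (by fun_prop)
  refine (hc.closure_subset_iff.2 ?_) hu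
  rintro w ⟨η, hη, h1, h2⟩
  obtain ⟨ξ, hξ, h3, h4⟩ := hp
  simp only [mem_ofPred_eq, inner_eq_setIntegral]
  rw [eq_neg_iff_add_eq_zero]
  have hprod : ContDiff ℝ ∞ (η * ξ) := hη.1.mul hξ.1
  have hz := setIntegral_deriv_eq_zero hL (hprod.of_le (by simp))
    (by simp [hη.apply_zero]) (by simp [hη.apply_right])
  have hd : deriv (η * ξ) = fun x => η x * deriv ξ x + deriv η x * ξ x := by
    funext x
    rw [deriv_mul (hη.differentiable x) (hξ.differentiable x)]
    ring
  have c1 := hη.1.continuous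
  have c2 := hξ.1.continuous
  have c3 := hη.contDiff_deriv.continuous
  have c4 := hξ.contDiff_deriv.continuous
  have i1 : Continuous fun x => η x * deriv ξ x := c1.mul c4
  have i2 : Continuous fun x => deriv η x * ξ x := c3.mul c2
  rw [hd, integral_add (integrable_restrict_Ioo i1) (integrable_restrict_Ioo i2)] at hz
  refine Eq.trans ?_ hz
  congr 1
  · refine integral_congr_ae ?_
    filter_upwards [h1, h4] with x hx hx'
    rw [hx, hx']
  · refine integral_congr_ae ?_
    filter_upwards [h2, h3] with x hx hx'
    rw [hx, hx']

/-- Derivatives of elements of `H¹₀` have mean zero. -/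
lemma inner_one_eq_zero_of_mem_H10 (hL : 0 ≤ L) {u ux : L2 L} (hu : (u, ux) ∈ H10 L) :
    inner ℝ (one L) ux = 0 := by
  rw [(hasWeakDeriv_one hL).inner_eq hu, inner_zero_left, neg_zero]

/-- The Poincaré inequality for test functions. The constant comes from integrating `(x η²)'`. -/
lemma IsTestFunction.setIntegral_sq_le (hL : 0 ≤ L) {η : ℝ → ℝ} (hη : IsTestFunction L η) :
    ∫ x in Ioo 0 L, η x ^ 2 ≤ (2 * L) ^ 2 * ∫ x in Ioo 0 L, deriv η x ^ 2 := by
  have c1 := hη.1.continuous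
  have c2 := hη.contDiff_deriv.continuous
  have hprod : ContDiff ℝ 1 (fun x => x * η x ^ 2) :=
    contDiff_id.mul ((hη.1.of_le (by simp)).pow 2)
  have hz := setIntegral_deriv_eq_zero hL hprod (by simp) (by simp [hη.apply_right])
  have hd : deriv (fun x => x * η x ^ 2) = fun x => η x ^ 2 + 2 * x * (η x * deriv η x) := by
    funext x
    have := (hasDerivAt_id x).mul ((hη.differentiable x).hasDerivAt.pow 2)
    refine (this.congr_deriv ?_).deriv
    simp
    ring
  rw [hd] at hz
  have i1 : Continuous fun x => 1 / 2 * η x ^ 2 := by fun_prop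
  have i2 : Continuous fun x => 2 * L ^ 2 * deriv η x ^ 2 := by fun_prop
  have i3 : Continuous fun x => η x ^ 2 + 2 * x * (η x * deriv η x) := by fun_prop
  have hmono : ∫ x in Ioo 0 L, (1 / 2 * η x ^ 2 - 2 * L ^ 2 * deriv η x ^ 2)
      ≤ ∫ x in Ioo 0 L, (η x ^ 2 + 2 * x * (η x * deriv η x)) := by
    refine setIntegral_mono_on (integrable_restrict_Ioo (i1.sub i2))
      (integrable_restrict_Ioo i3) measurableSet_Ioo fun x hx => ?_
    have hx2 : x ^ 2 ≤ L ^ 2 := pow_le_pow_left₀ hx.1.le hx.2.le 2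
    nlinarith [sq_nonneg (η x + 2 * x * deriv η x),
      mul_le_mul_of_nonneg_right hx2 (sq_nonneg (deriv η x))]
  rw [hz, integral_sub (integrable_restrict_Ioo i1) (integrable_restrict_Ioo i2),
    integral_const_mul, integral_const_mul] at hmono
  linarith

lemma norm_fst_le_of_mem_testGraph (hL : 0 ≤ L) {p : L2 L × L2 L} (hp : p ∈ testGraph L) :
    ‖p.1‖ ≤ 2 * L * ‖p.2‖ := by
  obtain ⟨η, hη, h1, h2⟩ := hp
  have e1 : ‖p.1‖ ^ 2 = ∫ x in Ioo 0 L, η x ^ 2 := by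
    rw [norm_sq_eq_setIntegral]
    refine integral_congr_ae ?_
    filter_upwards [h1] with x hx
    rw [hx]
  have e2 : ‖p.2‖ ^ 2 = ∫ x in Ioo 0 L, deriv η x ^ 2 := by
    rw [norm_sq_eq_setIntegral]
    refine integral_congr_ae ?_
    filter_upwards [h2] with x hx
    rw [hx]
  have h3 : ‖p.1‖ ^ 2 ≤ (2 * L * ‖p.2‖) ^ 2 := by
    rw [e1, mul_pow, e2]
    exact hη.setIntegral_sq_le hL
  exact (abs_le_of_sq_le_sq' h3 (by positivity)).2

/-- The Poincaré inequality on `H¹₀`. -/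
lemma poincare (hL : 0 ≤ L) {u ux : L2 L} (hu : (u, ux) ∈ H10 L) :
    ‖u‖ ≤ 2 * L * ‖ux‖ := by
  have hc : IsClosed {p : L2 L × L2 L | ‖p.1‖ ≤ 2 * L * ‖p.2‖} :=
    isClosed_le (by fun_prop) (by fun_prop)
  have key : ∀ p ∈ H10 L, ‖p.1‖ ≤ 2 * L * ‖p.2‖ := fun p hp =>
    closure_minimal (fun _ h => norm_fst_le_of_mem_testGraph hL h) hc hp
  exact key (u, ux) hu

/-- The primitive of a function with compact support in `(0, L)` and mean zero has compact
support in `(0, L)`. -/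
lemma IsTestFunction.exists_primitive (hL : 0 ≤ L) {g : ℝ → ℝ} (hg : IsTestFunction L g)
    (h0 : ∫ x in Ioo 0 L, g x = 0) : ∃ η, IsTestFunction L η ∧ deriv η = g := by
  have cg := hg.1.continuous
  obtain ⟨a, b, ha, hb, hab⟩ : ∃ a b : ℝ, 0 < a ∧ b < L ∧ tsupport g ⊆ Icc a b := by
    rcases (tsupport g).eq_empty_or_nonempty with he | hne
    · exact ⟨1, L - 1, one_pos, by linarith, by simp [he]⟩
    · have hK : IsCompact (tsupport g) := hg.2.1
      exact ⟨_, _, (hg.2.2 (hK.sInf_mem hne)).1, (hg.2.2 (hK.sSup_mem hne)).2,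
        fun x hx => ⟨csInf_le hK.bddBelow hx, le_csSup hK.bddAbove hx⟩⟩
  have hgz : ∀ x, x ∉ Icc a b → g x = 0 := fun x hx =>
    image_eq_zero_of_notMem_tsupport fun h => hx (hab h)
  have hder : ∀ x, HasDerivAt (fun x => ∫ s in (0 : ℝ)..x, g s) (g x) x := fun x =>
    intervalIntegral.integral_hasDerivAt_right (cg.intervalIntegrable _ _)
      cg.stronglyMeasurable.stronglyMeasurableAtFilter cg.continuousAt
  have hd : deriv (fun x => ∫ s in (0 : ℝ)..x, g s) = g := funext fun x => (hder x).deriv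
  have hLz : ∫ s in (0 : ℝ)..L, g s = 0 := by
    rw [intervalIntegral.integral_of_le hL, integral_Ioc_eq_integral_Ioo, h0]
  have hsupp : tsupport (fun x => ∫ s in (0 : ℝ)..x, g s) ⊆ Icc a b := by
    refine closure_minimal (fun x hx => ?_) isClosed_Icc
    by_contra hn
    refine hx ?_
    beta_reduce
    rw [mem_Icc, not_and_or, not_le, not_le] at hn
    rcases hn with hn | hn
    · rw [intervalIntegral.integral_congr (g := fun _ => 0), intervalIntegral.integral_zero]
      intro s hs
      refine hgz s fun hs' => ?_
      have := hs.2
      have h3 : max 0 x < a := max_lt ha hn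
      exact absurd (this.trans_lt h3) (not_lt.2 hs'.1)
    · have hadd := intervalIntegral.integral_add_adjacent_intervals
        (cg.intervalIntegrable 0 L) (cg.intervalIntegrable (μ := volume) L x)
      rw [← hadd, hLz, zero_add,
        intervalIntegral.integral_congr (g := fun _ => 0), intervalIntegral.integral_zero]
      intro s hs
      refine hgz s fun hs' => ?_
      have := hs.1
      have h3 : b < min L x := lt_min hb hn
      exact absurd (h3.trans_le this) (not_lt.2 hs'.2)
  refine ⟨_, ⟨contDiff_infty_iff_deriv.2 ⟨fun x => (hder x).differentiableAt, ?_⟩,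
    isCompact_Icc.of_isClosed_subset (isClosed_tsupport _) hsupp,
    fun x hx => ⟨ha.trans_le (hsupp hx).1, (hsupp hx).2.trans_lt hb⟩⟩, hd⟩
  rw [hd]
  exact hg.1

lemma exists_isTestFunction_integral_eq_one (hL : 0 < L) :
    ∃ χ, IsTestFunction L χ ∧ ∫ x in Ioo 0 L, χ x = 1 := by
  let f : ContDiffBump (L / 2) := ⟨L / 8, L / 4, by linarith, by linarith⟩
  have hs : tsupport (f.normed volume) ⊆ Ioo 0 L := by
    rw [f.tsupport_normed_eq, Real.closedBall_eq_Icc]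
    intro x hx
    have hr : f.rOut = L / 4 := rfl
    rw [hr] at hx
    exact ⟨by linarith [hx.1], by linarith [hx.2]⟩
  refine ⟨f.normed volume, ⟨f.contDiff_normed, f.hasCompactSupport_normed, hs⟩, ?_⟩
  rw [setIntegral_eq_integral_of_forall_compl_eq_zero, f.integral_normed]
  exact fun x hx => image_eq_zero_of_notMem_tsupport fun h => hx (hs h)

/-- The lemma of du Bois-Reymond: a function orthogonal to all derivatives of test functions is
constant. -/
lemma exists_eq_smul_one (hL : 0 < L) {v : L2 L}
    (hv : ∀ p ∈ testGraph L, inner ℝ v p.2 = 0) : ∃ c : ℝ, v = c • one L := by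
  obtain ⟨χ, hχ, hχ1⟩ := exists_isTestFunction_integral_eq_one hL
  set c : ℝ := ∫ x in Ioo 0 L, v x * χ x
  have hvi : LocallyIntegrable v (volume.restrict (Ioo 0 L)) :=
    (Lp.memLp v).locallyIntegrable (by norm_num)
  have int : ∀ η, IsTestFunction L η → Integrable (fun x => v x * η x)
      (volume.restrict (Ioo 0 L)) := fun η hη =>
    (Lp.memLp v).integrable_mul (q := 2)
      ((hη.1.continuous.memLp_of_hasCompactSupport hη.2.1).restrict _)
  have hae := isOpen_Ioo.ae_eq_zero_of_integral_contDiff_smul_eq_zero (U := Ioo 0 L)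
    (μ := volume.restrict (Ioo 0 L)) (f := fun x => v x - c)
    ((hvi.sub (locallyIntegrable_const c)).locallyIntegrableOn _) ?_
  · refine ⟨c, Lp.ext ?_⟩
    filter_upwards [hae, ae_restrict_mem measurableSet_Ioo, Lp.coeFn_smul c (one L),
      coeFn_one (L := L)] with x h1 h2 h3 h4
    rw [h3, Pi.smul_apply, h4]
    simpa using sub_eq_zero.1 (h1 h2)
  · intro f hf1 hf2 hf3
    have hf : IsTestFunction L f := ⟨hf1, hf2, hf3⟩
    set m : ℝ := ∫ x in Ioo 0 L, f x
    -- Subtracting a multiple of `χ` makes the mean zero, so a primitive is a test function.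
    have hg : IsTestFunction L (fun x => f x - m * χ x) := by
      refine ⟨hf1.sub (contDiff_const.mul hχ.1), hf2.sub hχ.2.1.mul_left, ?_⟩
      refine (tsupport_sub f _).trans (union_subset hf3 ?_)
      exact (tsupport_mul_subset_right (f := fun _ => m)).trans hχ.2.2
    have if1 := integrable_restrict_Ioo (L := L) hf.1.continuous
    have iχ := integrable_restrict_Ioo (L := L) hχ.1.continuous
    obtain ⟨η, hη, hd⟩ := hg.exists_primitive hL.le (by
      rw [integral_sub if1 (iχ.const_mul m), integral_const_mul, hχ1]
      simp [m])
    obtain ⟨p, hp, -, h2⟩ := hη.exists_mem_testGraph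
    have h3 := hv p hp
    rw [inner_eq_setIntegral] at h3
    have h4 : ∫ x in Ioo 0 L, v x * p.2 x
        = ∫ x in Ioo 0 L, (v x * f x - m * (v x * χ x)) := by
      refine integral_congr_ae ?_
      filter_upwards [h2] with x hx
      rw [hx, hd]
      ring
    rw [h3, integral_sub (int f hf) ((int χ hχ).const_mul m), integral_const_mul] at h4
    have h5 : ∫ x in Ioo 0 L, f x • (v x - c) = ∫ x in Ioo 0 L, (v x * f x - c * f x) := by
      congr 1
      funext x
      simp only [smul_eq_mul]
      ring
    rw [h5, integral_sub (int f hf) (if1.const_mul c), integral_const_mul]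
    linarith [mul_comm m c]

/-- A function of mean zero has a primitive in `H¹₀`: by the Poincaré inequality the derivatives
of elements of `H¹₀` form a closed subspace, and its orthogonal complement consists of
constants. -/
lemma exists_mem_H10_of_inner_one_eq_zero (hL : 0 < L) {f : L2 L}
    (hf : inner ℝ (one L) f = 0) : ∃ u : L2 L, (u, f) ∈ H10 L := by
  let D : H10 L →L[ℝ] L2 L := (ContinuousLinearMap.snd ℝ (L2 L) (L2 L)).comp (H10 L).subtypeL
  have hD : AntilipschitzWith (Real.toNNReal (max (2 * L) 1)) D := by
    refine D.antilipschitz_of_bound fun w => ?_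
    rw [Real.coe_toNNReal _ (by positivity)]
    have h1 : ‖w.1.1‖ ≤ 2 * L * ‖w.1.2‖ := poincare hL.le w.2
    have h2 : D w = w.1.2 := rfl
    have h3 : ‖w‖ = max ‖w.1.1‖ ‖w.1.2‖ := rfl
    rw [h2, h3]
    refine max_le (h1.trans ?_) ?_
    · gcongr
      exact le_max_left _ _
    · exact le_mul_of_one_le_left (norm_nonneg _) (le_max_right _ _)
  have hcl : IsClosed (D.range : Set (L2 L)) := by
    exact hD.isClosed_range D.uniformContinuous
  have : CompleteSpace D.range := hcl.completeSpace_coe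
  have hmem : f ∈ D.range := by
    rw [← Submodule.orthogonal_orthogonal D.range, Submodule.mem_orthogonal]
    intro v hv
    obtain ⟨c, rfl⟩ := exists_eq_smul_one hL (v := v) fun p hp => by
      rw [Submodule.mem_orthogonal] at hv
      rw [real_inner_comm]
      exact hv _ ⟨⟨p, (testGraph L).le_topologicalClosure hp⟩, rfl⟩
    rw [real_inner_smul_left, hf, mul_zero]
  obtain ⟨w, rfl⟩ := hmem
  exact ⟨w.1.1, w.2⟩

/-- The projection of `L²((0, L))` onto the functions of mean zero. -/
def meanFree (L : ℝ) : L2 L →L[ℝ] L2 L :=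
  ContinuousLinearMap.id ℝ _ - (innerSL ℝ (one L)).smulRight (L⁻¹ • one L)

lemma meanFree_apply (f : L2 L) :
    meanFree L f = f - (L⁻¹ * inner ℝ (one L) f) • one L := by
  simp [meanFree, smul_smul, mul_comm]

lemma inner_one_meanFree (hL : 0 < L) (f : L2 L) : inner ℝ (one L) (meanFree L f) = 0 := by
  rw [meanFree_apply, inner_sub_right, inner_smul_right, inner_one_one hL.le]
  field_simp
  ring

lemma meanFree_eq_self {f : L2 L} (hf : inner ℝ (one L) f = 0) : meanFree L f = f := by
  simp [meanFree_apply, hf]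

/-- An element of `H¹₀` is determined by its derivative. -/
lemma eq_of_mem_H10 (hL : 0 ≤ L) {u v f : L2 L} (hu : (u, f) ∈ H10 L) (hv : (v, f) ∈ H10 L) :
    u = v := by
  have h := poincare hL (u := u - v) (ux := f - f) ((H10 L).sub_mem hu hv)
  rw [sub_self, norm_zero, mul_zero] at h
  exact sub_eq_zero.1 (norm_le_zero_iff.1 h)

/-- There is a bounded operator taking `f` to the primitive in `H¹₀` of its mean-free part. -/
lemma exists_primitiveOperator (hL : 0 < L) :
    ∃ J : L2 L →L[ℝ] L2 L, ∀ f, (J f, meanFree L f) ∈ H10 L := by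
  choose J hJ using fun f : L2 L =>
    exists_mem_H10_of_inner_one_eq_zero hL (inner_one_meanFree hL f)
  let J' : L2 L →ₗ[ℝ] L2 L :=
    { toFun := J
      map_add' := fun f g => eq_of_mem_H10 hL.le (hJ (f + g)) (by
        rw [map_add]
        exact (H10 L).add_mem (hJ f) (hJ g))
      map_smul' := fun c f => eq_of_mem_H10 hL.le (hJ (c • f)) (by
        rw [map_smul]
        exact (H10 L).smul_mem c (hJ f)) }
  refine ⟨J'.mkContinuous (2 * L * ‖meanFree L‖) fun f => ?_, hJ⟩
  calc ‖J f‖ ≤ 2 * L * ‖meanFree L f‖ := poincare hL.le (hJ f)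
    _ ≤ 2 * L * (‖meanFree L‖ * ‖f‖) := by gcongr; exact (meanFree L).le_opNorm f
    _ = 2 * L * ‖meanFree L‖ * ‖f‖ := by ring

/-! ### Components of a state -/

namespace State

lemma mem_H10_φ (V : State L) : (V.φ, V.φx) ∈ H10 L := V.1.2

lemma mem_H10_ψ (V : State L) : (V.ψ, V.ψx) ∈ H10 L := V.2.2.1.2

/-- The component `φ` as a bounded operator. -/
def φL (L : ℝ) : State L →L[ℝ] L2 L :=
  .comp (.fst ℝ _ _) (.comp (H10 L).subtypeL (.fst ℝ _ _))

/-- The component `φₓ` as a bounded operator. -/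
def φxL (L : ℝ) : State L →L[ℝ] L2 L :=
  .comp (.snd ℝ _ _) (.comp (H10 L).subtypeL (.fst ℝ _ _))

/-- The component `φₜ` as a bounded operator. -/
def φtL (L : ℝ) : State L →L[ℝ] L2 L := .comp (.fst ℝ _ _) (.snd ℝ _ _)

/-- The component `ψ` as a bounded operator. -/
def ψL (L : ℝ) : State L →L[ℝ] L2 L :=
  .comp (.fst ℝ _ _) (.comp (H10 L).subtypeL (.comp (.fst ℝ _ _) (.comp (.snd ℝ _ _) (.snd ℝ _ _))))

/-- The component `ψₓ` as a bounded operator. -/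
def ψxL (L : ℝ) : State L →L[ℝ] L2 L :=
  .comp (.snd ℝ _ _) (.comp (H10 L).subtypeL (.comp (.fst ℝ _ _) (.comp (.snd ℝ _ _) (.snd ℝ _ _))))

/-- The component `ψₜ` as a bounded operator. -/
def ψtL (L : ℝ) : State L →L[ℝ] L2 L :=
  .comp (.fst ℝ _ _) (.comp (.snd ℝ _ _) (.comp (.snd ℝ _ _) (.snd ℝ _ _)))

/-- The component `θ` as a bounded operator. -/
def θL (L : ℝ) : State L →L[ℝ] L2 L :=
  .comp (.fst ℝ _ _) (.comp (.snd ℝ _ _) (.comp (.snd ℝ _ _) (.comp (.snd ℝ _ _) (.snd ℝ _ _))))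

/-- The component `q` as a bounded operator. -/
def qL (L : ℝ) : State L →L[ℝ] L2 L :=
  .comp (.snd ℝ _ _) (.comp (.snd ℝ _ _) (.comp (.snd ℝ _ _) (.comp (.snd ℝ _ _) (.snd ℝ _ _))))

end State

open State

lemma hasDerivWithinAt_clm {V : ℝ → State L} {W : State L} {s : Set ℝ} {t : ℝ}
    (h : HasDerivWithinAt V W s t) (T : State L →L[ℝ] L2 L) :
    HasDerivWithinAt (fun r => T (V r)) (T W) s t :=
  T.hasFDerivAt.comp_hasDerivWithinAt t h

/-! ### The energy -/

/-- The energy of a state in terms of norms in `L²`, with `ϑ` in place of the temperature. -/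
def normEnergy (p : Params) (V : State p.L) (ϑ : L2 p.L) : ℝ :=
  1 / 2 * (p.ρ₁ * ‖V.φt‖ ^ 2 + p.ρ₂ * ‖V.ψt‖ ^ 2 + p.b * ‖V.ψx‖ ^ 2
    + p.k * ‖V.φx + V.ψ‖ ^ 2 + p.ρ₃ * ‖ϑ‖ ^ 2 + p.τ₀ * ‖V.q‖ ^ 2)

lemma integrable_sq (u : L2 L) : Integrable (fun x => u x ^ 2) (volume.restrict (Ioo 0 L)) :=
  (Lp.memLp u).integrable_sq

lemma E_eq_normEnergy (p : Params) (V : ℝ → State p.L) (t : ℝ) :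
    E p V t = normEnergy p (V t)
      ((V t).θ - (p.L⁻¹ * inner ℝ (one p.L) (V 0).θ) • one p.L) := by
  set ϑ : L2 p.L := (V t).θ - (p.L⁻¹ * inner ℝ (one p.L) (V 0).θ) • one p.L with hϑ
  have hϑ' : ϑ =ᵐ[volume.restrict (Ioo 0 p.L)] thetaBar p V t := by
    filter_upwards [Lp.coeFn_sub (V t).θ ((p.L⁻¹ * inner ℝ (one p.L) (V 0).θ) • one p.L),
      Lp.coeFn_smul (p.L⁻¹ * inner ℝ (one p.L) (V 0).θ) (one p.L), coeFn_one (L := p.L)]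
      with x h1 h2 h3
    rw [hϑ, h1, Pi.sub_apply, h2, Pi.smul_apply, h3, inner_one_left, thetaBar]
    simp
  have hS := Lp.coeFn_add (V t).φx (V t).ψ
  have h : ∫ x in Ioo 0 p.L,
      (p.ρ₁ * (V t).φt x ^ 2 + p.ρ₂ * (V t).ψt x ^ 2 + p.b * (V t).ψx x ^ 2
        + p.k * ((V t).φx x + (V t).ψ x) ^ 2 + p.ρ₃ * thetaBar p V t x ^ 2
        + p.τ₀ * (V t).q x ^ 2)
      = ∫ x in Ioo 0 p.L,
      (p.ρ₁ * (V t).φt x ^ 2 + p.ρ₂ * (V t).ψt x ^ 2 + p.b * (V t).ψx x ^ 2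
        + p.k * ((V t).φx + (V t).ψ) x ^ 2 + p.ρ₃ * ϑ x ^ 2
        + p.τ₀ * (V t).q x ^ 2) := by
    refine integral_congr_ae ?_
    filter_upwards [hϑ', hS] with x h1 h2
    rw [h1, h2, Pi.add_apply]
  have i1 := (integrable_sq (V t).φt).const_mul p.ρ₁
  have i2 := (integrable_sq (V t).ψt).const_mul p.ρ₂
  have i3 := (integrable_sq (V t).ψx).const_mul p.b
  have i4 := (integrable_sq ((V t).φx + (V t).ψ)).const_mul p.k
  have i5 := (integrable_sq ϑ).const_mul p.ρ₃
  have i6 := (integrable_sq (V t).q).const_mul p.τ₀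
  rw [E, energy, h, integral_add ((((i1.fun_add i2).fun_add i3).fun_add i4).fun_add i5) i6,
    integral_add (((i1.fun_add i2).fun_add i3).fun_add i4) i5,
    integral_add ((i1.fun_add i2).fun_add i3) i4,
    integral_add (i1.fun_add i2) i3, integral_add i1 i2]
  simp only [integral_const_mul, ← norm_sq_eq_setIntegral, normEnergy]

lemma continuous_normEnergy (p : Params) {X : Type*} [TopologicalSpace X] {f : X → State p.L}
    {g : X → L2 p.L} (hf : Continuous f) (hg : Continuous g) :
    Continuous fun x => normEnergy p (f x) (g x) := by
  have h1 : Continuous fun x => (f x).φt := (φtL p.L).continuous.comp hf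
  have h2 : Continuous fun x => (f x).ψt := (ψtL p.L).continuous.comp hf
  have h3 : Continuous fun x => (f x).ψx := (ψxL p.L).continuous.comp hf
  have h4 : Continuous fun x => (f x).φx := (φxL p.L).continuous.comp hf
  have h5 : Continuous fun x => (f x).ψ := (ψL p.L).continuous.comp hf
  have h6 : Continuous fun x => (f x).q := (qL p.L).continuous.comp hf
  have h7 : Continuous fun x => (f x).φx + (f x).ψ := h4.add h5
  unfold normEnergy
  fun_prop

/-! ### The weak form of the equations -/

/-- The relation `A V = W` tested against `H¹₀`. The boundary terms vanish, and since derivatives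
of `H¹₀` functions have mean zero, `θ` enters only through its mean-free part. -/
structure IsWeakRel (p : Params) (V W : State p.L) : Prop where
  φ_eq : W.φ = V.φt
  ψ_eq : W.ψ = V.ψt
  φt_eq : ∀ w wx : L2 p.L, (w, wx) ∈ H10 p.L →
    p.ρ₁ * inner ℝ W.φt w = -p.k * inner ℝ (V.φx + V.ψ) wx - p.μ * inner ℝ V.φt w
  ψt_eq : ∀ w wx : L2 p.L, (w, wx) ∈ H10 p.L →
    p.ρ₂ * inner ℝ W.ψt w = -p.b * inner ℝ V.ψx wx - p.k * inner ℝ (V.φx + V.ψ) w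
      + p.γ * inner ℝ (meanFree p.L V.θ) wx
  q_eq : ∀ w wx : L2 p.L, (w, wx) ∈ H10 p.L →
    p.τ₀ * inner ℝ W.q w = -p.δ * inner ℝ V.q w + p.κ * inner ℝ (meanFree p.L V.θ) wx
  θ_eq : ∃ qx : L2 p.L, (V.q, qx) ∈ H10 p.L ∧ p.ρ₃ • W.θ = -(p.κ • qx + p.γ • W.ψx)

lemma inner_meanFree_left (hL : 0 ≤ L) (f : L2 L) {w wx : L2 L} (hw : (w, wx) ∈ H10 L) :
    inner ℝ (meanFree L f) wx = inner ℝ f wx := by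
  rw [meanFree_apply, inner_sub_left, real_inner_smul_left, inner_one_eq_zero_of_mem_H10 hL hw,
    mul_zero, sub_zero]

lemma GeneratorRel.isWeakRel {p : Params} (hL : 0 ≤ p.L) {V W : State p.L}
    (h : GeneratorRel p V W) : IsWeakRel p V W := by
  obtain ⟨φxx, ψxx, φtx, ψtx, θx, qx, hφt, hψt, hq, hφxx, hψxx, hθx, e1, e2, e3, e4, e5, e6⟩ := h
  have eφ : W.φ = V.φt := congrArg (fun w : H10 p.L => w.1.1) e1
  have eψ : W.ψ = V.ψt := congrArg (fun w : H10 p.L => w.1.1) e3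
  have eψx : W.ψx = ψtx := congrArg (fun w : H10 p.L => w.1.2) e3
  refine ⟨eφ, eψ, fun w wx hw => ?_, fun w wx hw => ?_, fun w wx hw => ?_, qx, hq, ?_⟩
  · have h1 := (hφxx.add (hasWeakDeriv_of_mem_H10 hL V.mem_H10_ψ)).inner_eq hw
    have h2 := congrArg (fun f : L2 p.L => inner ℝ f w) e2
    simp only [inner_add_left, inner_sub_left, real_inner_smul_left, inner_zero_left] at h1 h2 ⊢
    linear_combination h2 + p.k * h1
  · have h1 := hψxx.inner_eq hw
    have h2 := congrArg (fun f : L2 p.L => inner ℝ f w) e4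
    have h3 := hθx.inner_eq hw
    rw [inner_meanFree_left hL _ hw]
    simp only [inner_add_left, inner_sub_left, real_inner_smul_left, inner_zero_left] at h2 ⊢
    linear_combination h2 + p.b * h1 - p.γ * h3
  · have h2 := congrArg (fun f : L2 p.L => inner ℝ f w) e6
    have h3 := hθx.inner_eq hw
    rw [inner_meanFree_left hL _ hw]
    simp only [inner_add_left, real_inner_smul_left, inner_zero_left] at h2
    linear_combination h2 - p.κ * h3
  · rw [eψx, eq_neg_iff_add_eq_zero, ← e5, add_assoc]

namespace IsWeakRel

variable {p : Params} {V W : State p.L}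

lemma mem_H10_φt (h : IsWeakRel p V W) : (V.φt, W.φx) ∈ H10 p.L := h.φ_eq ▸ W.mem_H10_φ

lemma mem_H10_ψt (h : IsWeakRel p V W) : (V.ψt, W.ψx) ∈ H10 p.L := h.ψ_eq ▸ W.mem_H10_ψ

/-- The heat balance, integrated once in space. -/
lemma mem_H10_flux (h : IsWeakRel p V W) :
    (-(p.κ • V.q + p.γ • V.ψt), p.ρ₃ • W.θ) ∈ H10 p.L := by
  obtain ⟨qx, hq, he⟩ := h.θ_eq
  rw [he]
  exact (H10 p.L).neg_mem
    ((H10 p.L).add_mem ((H10 p.L).smul_mem p.κ hq) ((H10 p.L).smul_mem p.γ h.mem_H10_ψt))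

lemma inner_one_θ (h : IsWeakRel p V W) (hL : 0 ≤ p.L) (hρ₃ : 0 < p.ρ₃) :
    inner ℝ (one p.L) W.θ = 0 := by
  have := inner_one_eq_zero_of_mem_H10 hL h.mem_H10_flux
  rw [inner_smul_right] at this
  exact (mul_eq_zero.1 this).resolve_left hρ₃.ne'

lemma primitive_θ (h : IsWeakRel p V W) (hL : 0 ≤ p.L) (hρ₃ : 0 < p.ρ₃)
    {J : L2 p.L →L[ℝ] L2 p.L} (hJ : ∀ f, (J f, meanFree p.L f) ∈ H10 p.L) :
    p.ρ₃ • J W.θ = -(p.κ • V.q + p.γ • V.ψt) := by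
  have h1 : (p.ρ₃ • J W.θ, p.ρ₃ • W.θ) ∈ H10 p.L := by
    have := (H10 p.L).smul_mem p.ρ₃ (hJ W.θ)
    rwa [meanFree_eq_self (h.inner_one_θ hL hρ₃)] at this
  exact eq_of_mem_H10 hL h1 h.mem_H10_flux

end IsWeakRel

/-! ### Multiplier identities -/

section Multipliers

variable {p : Params} {V : ℝ → State p.L} {W : State p.L} {s : Set ℝ} {t : ℝ}

/-- Dissipation of energy. -/
lemma hasDerivWithinAt_normEnergy (hL : 0 ≤ p.L) (hρ₃ : 0 < p.ρ₃)
    (hV : HasDerivWithinAt V W s t) (h : IsWeakRel p (V t) W) :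
    HasDerivWithinAt (fun r => normEnergy p (V r) (meanFree p.L (V r).θ))
      (-p.μ * ‖(V t).φt‖ ^ 2 - p.δ * ‖(V t).q‖ ^ 2) s t := by
  have d1 := (hasDerivWithinAt_clm hV (φtL p.L)).norm_sq
  have d2 := (hasDerivWithinAt_clm hV (ψtL p.L)).norm_sq
  have d3 := (hasDerivWithinAt_clm hV (ψxL p.L)).norm_sq
  have d4 := (hasDerivWithinAt_clm hV (φxL p.L + ψL p.L)).norm_sq
  have d5 := (hasDerivWithinAt_clm hV ((meanFree p.L).comp (θL p.L))).norm_sq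
  have d6 := (hasDerivWithinAt_clm hV (qL p.L)).norm_sq
  have d := ((((((d1.const_mul p.ρ₁).add (d2.const_mul p.ρ₂)).add (d3.const_mul p.b)).add
    (d4.const_mul p.k)).add (d5.const_mul p.ρ₃)).add (d6.const_mul p.τ₀)).const_mul (1 / 2)
  refine d.congr_deriv ?_
  obtain ⟨qx, hq, he⟩ := h.θ_eq
  have a1 := h.φt_eq _ _ h.mem_H10_φt
  have a2 := h.ψt_eq _ _ h.mem_H10_ψt
  have a3 := h.q_eq _ _ hq
  have a4 := congrArg (fun f : L2 p.L => inner ℝ (meanFree p.L (V t).θ) f) he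
  have a5 : meanFree p.L W.θ = W.θ := meanFree_eq_self (h.inner_one_θ hL hρ₃)
  have a6 := h.ψ_eq
  change 1 / 2 * (p.ρ₁ * (2 * inner ℝ (V t).φt W.φt) + p.ρ₂ * (2 * inner ℝ (V t).ψt W.ψt)
    + p.b * (2 * inner ℝ (V t).ψx W.ψx)
    + p.k * (2 * inner ℝ ((V t).φx + (V t).ψ) (W.φx + W.ψ))
    + p.ρ₃ * (2 * inner ℝ (meanFree p.L (V t).θ) (meanFree p.L W.θ))
    + p.τ₀ * (2 * inner ℝ (V t).q W.q)) = _
  rw [a5, a6, real_inner_comm W.φt, real_inner_comm W.ψt, real_inner_comm W.q,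
    inner_add_right ((V t).φx + (V t).ψ)]
  simp only [inner_smul_right, inner_neg_right, inner_add_right] at a4
  rw [real_inner_self_eq_norm_sq] at a1 a3
  linear_combination a1 + a2 + a3 + a4

/-- The multiplier for the temperature: the primitive of `θ̄` tested in Cattaneo's law. -/
lemma hasDerivWithinAt_inner_q (hL : 0 ≤ p.L) (hρ₃ : 0 < p.ρ₃)
    {J : L2 p.L →L[ℝ] L2 p.L} (hJ : ∀ f, (J f, meanFree p.L f) ∈ H10 p.L)
    (hV : HasDerivWithinAt V W s t) (h : IsWeakRel p (V t) W) :
    HasDerivWithinAt (fun r => -p.τ₀ * inner ℝ (V r).q (J (V r).θ))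
      (p.τ₀ / p.ρ₃ * (p.κ * ‖(V t).q‖ ^ 2 + p.γ * inner ℝ (V t).q (V t).ψt)
        + p.δ * inner ℝ (V t).q (J (V t).θ) - p.κ * ‖meanFree p.L (V t).θ‖ ^ 2) s t := by
  have d1 := hasDerivWithinAt_clm hV (qL p.L)
  have d2 := hasDerivWithinAt_clm hV (J.comp (θL p.L))
  refine ((d1.inner ℝ d2).const_mul (-p.τ₀)).congr_deriv ?_
  have a1 := h.q_eq _ _ (hJ (V t).θ)
  have a2 := congrArg (fun f : L2 p.L => inner ℝ (V t).q f) (h.primitive_θ hL hρ₃ hJ)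
  change -p.τ₀ * (inner ℝ (V t).q (J W.θ) + inner ℝ W.q (J (V t).θ)) = _
  simp only [inner_smul_right, inner_neg_right, inner_add_right] at a2
  rw [real_inner_self_eq_norm_sq] at a1 a2
  field_simp
  linear_combination -p.ρ₃ * a1 - p.τ₀ * a2

/-- The multiplier for the angular velocity: the heat balance, integrated once in space and tested
with `ψₜ`. -/
lemma hasDerivWithinAt_inner_ψt (hL : 0 ≤ p.L) (hρ₃ : 0 < p.ρ₃)
    {J : L2 p.L →L[ℝ] L2 p.L} (hJ : ∀ f, (J f, meanFree p.L f) ∈ H10 p.L)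
    (hV : HasDerivWithinAt V W s t) (h : IsWeakRel p (V t) W) :
    HasDerivWithinAt (fun r => p.ρ₂ * p.ρ₃ * inner ℝ (J (V r).θ) (V r).ψt)
      (p.ρ₃ * (-p.b * inner ℝ (V t).ψx (meanFree p.L (V t).θ)
          - p.k * inner ℝ ((V t).φx + (V t).ψ) (J (V t).θ)
          + p.γ * ‖meanFree p.L (V t).θ‖ ^ 2)
        - p.ρ₂ * (p.κ * inner ℝ (V t).q (V t).ψt + p.γ * ‖(V t).ψt‖ ^ 2)) s t := by
  have d1 := hasDerivWithinAt_clm hV (ψtL p.L)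
  have d2 := hasDerivWithinAt_clm hV (J.comp (θL p.L))
  refine ((d2.inner ℝ d1).const_mul (p.ρ₂ * p.ρ₃)).congr_deriv ?_
  have a1 := h.ψt_eq _ _ (hJ (V t).θ)
  have a2 := congrArg (fun f : L2 p.L => inner ℝ f (V t).ψt) (h.primitive_θ hL hρ₃ hJ)
  change p.ρ₂ * p.ρ₃ * (inner ℝ (J (V t).θ) W.ψt + inner ℝ (J W.θ) (V t).ψt) = _
  simp only [real_inner_smul_left, inner_neg_left, inner_add_left (p.κ • _)] at a2
  rw [real_inner_self_eq_norm_sq] at a1 a2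
  rw [real_inner_comm W.ψt]
  linear_combination p.ρ₃ * a1 + p.ρ₂ * a2

/-- The multiplier for the elastic energy. The term `μ/2 ‖φ‖²` absorbs the frictional damping. -/
lemma hasDerivWithinAt_inner_φ_ψ
    (hV : HasDerivWithinAt V W s t) (h : IsWeakRel p (V t) W) :
    HasDerivWithinAt (fun r => p.ρ₂ * inner ℝ (V r).ψt (V r).ψ + p.ρ₁ * inner ℝ (V r).φt (V r).φ
        + p.μ / 2 * ‖(V r).φ‖ ^ 2)
      (p.ρ₂ * ‖(V t).ψt‖ ^ 2 + p.ρ₁ * ‖(V t).φt‖ ^ 2 - p.b * ‖(V t).ψx‖ ^ 2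
        - p.k * ‖(V t).φx + (V t).ψ‖ ^ 2
        + p.γ * inner ℝ (meanFree p.L (V t).θ) (V t).ψx) s t := by
  have d1 := hasDerivWithinAt_clm hV (ψtL p.L)
  have d2 := hasDerivWithinAt_clm hV (ψL p.L)
  have d3 := hasDerivWithinAt_clm hV (φtL p.L)
  have d4 := hasDerivWithinAt_clm hV (φL p.L)
  refine ((((d1.inner ℝ d2).const_mul p.ρ₂).add ((d3.inner ℝ d4).const_mul p.ρ₁)).add
    (d4.norm_sq.const_mul (p.μ / 2))).congr_deriv ?_
  have a1 := h.ψt_eq _ _ (V t).mem_H10_ψ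
  have a2 := h.φt_eq _ _ (V t).mem_H10_φ
  change p.ρ₂ * (inner ℝ (V t).ψt W.ψ + inner ℝ W.ψt (V t).ψ)
    + p.ρ₁ * (inner ℝ (V t).φt W.φ + inner ℝ W.φt (V t).φ)
    + p.μ / 2 * (2 * inner ℝ (V t).φ W.φ) = _
  have a3 : inner ℝ ((V t).φx + (V t).ψ) (V t).φx + inner ℝ ((V t).φx + (V t).ψ) (V t).ψ
      = ‖(V t).φx + (V t).ψ‖ ^ 2 := by
    rw [← inner_add_right, real_inner_self_eq_norm_sq]
  rw [h.φ_eq, h.ψ_eq, real_inner_self_eq_norm_sq, real_inner_self_eq_norm_sq,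
    real_inner_comm (V t).φt (V t).φ]
  rw [real_inner_self_eq_norm_sq] at a1
  linear_combination a1 + a2 - p.k * a3

end Multipliers

/-! ### The Lyapunov functional -/

/-- Young's inequality with a weight. -/
lemma mul_mul_le_sq_add {ε : ℝ} (hε : 0 < ε) (A x y : ℝ) :
    A * x * y ≤ ε * x ^ 2 + A ^ 2 / (4 * ε) * y ^ 2 := by
  have h : ε * x ^ 2 + A ^ 2 / (4 * ε) * y ^ 2 - A * x * y
      = (2 * ε * x - A * y) ^ 2 / (4 * ε) := by
    field_simp
    ring
  have : 0 ≤ (2 * ε * x - A * y) ^ 2 / (4 * ε) := by positivity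
  linarith

/-- Choice of the weights of the Lyapunov functional. Here `a`, `d`, `e`, `s`, `h`, `g` stand for
the norms of `φₜ`, `ψₜ`, `ψₓ`, `φₓ + ψ`, `θ̄`, `q`, and `D₀`, …, `D₃` for the derivatives of the
energy and of the three multiplier functionals. -/
lemma exists_weights (p : Params) (hρ₁ : 0 < p.ρ₁) (hρ₂ : 0 < p.ρ₂) (hρ₃ : 0 < p.ρ₃)
    (hb : 0 < p.b) (hk : 0 < p.k) (hγ : 0 < p.γ) (hκ : 0 < p.κ) (hδ : 0 < p.δ)
    (hτ₀ : 0 < p.τ₀) (hμ : 0 < p.μ) (M : ℝ) :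
    ∃ n₁ n₂ : ℝ, 0 < n₁ ∧ 0 < n₂ ∧ ∀ n₀ : ℝ, ∃ n, n₀ ≤ n ∧ ∀ a d e s h g D₀ D₁ D₂ D₃ : ℝ,
      D₀ = -p.μ * a ^ 2 - p.δ * g ^ 2 →
      D₁ ≤ p.τ₀ / p.ρ₃ * (p.κ * g ^ 2 + p.γ * (g * d)) + p.δ * (g * (M * h)) - p.κ * h ^ 2 →
      D₂ ≤ p.ρ₃ * (p.b * (e * h) + p.k * (s * (M * h)) + p.γ * h ^ 2)
        + p.ρ₂ * (p.κ * (g * d) - p.γ * d ^ 2) →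
      D₃ ≤ p.ρ₂ * d ^ 2 + p.ρ₁ * a ^ 2 - p.b * e ^ 2 - p.k * s ^ 2 + p.γ * (h * e) →
      n * D₀ + (n₁ * D₁ + n₂ * D₂ + D₃) ≤ -(1 / 2) * (1 / 2 * (p.ρ₁ * a ^ 2 + p.ρ₂ * d ^ 2
        + p.b * e ^ 2 + p.k * s ^ 2 + p.ρ₃ * h ^ 2 + p.τ₀ * g ^ 2)) := by
  -- `n₂` makes the `ψₜ` term of `n₂ D₂` dominate that of `D₃`.
  obtain ⟨n₂, hn₂⟩ : ∃ n₂, n₂ = 2 / p.γ := ⟨_, rfl⟩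
  have hn₂' : n₂ * p.γ = 2 := by rw [hn₂]; field_simp
  have hn₂p : 0 < n₂ := by rw [hn₂]; positivity
  obtain ⟨A, hA⟩ : ∃ A, A = n₂ * p.ρ₂ * p.κ := ⟨_, rfl⟩
  obtain ⟨B, hB⟩ : ∃ B, B = n₂ * p.ρ₃ * p.b := ⟨_, rfl⟩
  obtain ⟨C, hC⟩ : ∃ C, C = n₂ * p.ρ₃ * p.k * M := ⟨_, rfl⟩
  -- `H` collects the coefficients of `‖θ̄‖²` that `n₁ D₁` has to dominate.
  obtain ⟨H, hH⟩ : ∃ H, H = p.γ ^ 2 / (4 * (p.b / 2)) + B ^ 2 / (4 * (p.b / 4))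
    + C ^ 2 / (4 * (p.k / 4)) + n₂ * p.ρ₃ * p.γ := ⟨_, rfl⟩
  have hHp : 0 ≤ H := by rw [hH]; positivity
  obtain ⟨n₁, hn₁⟩ : ∃ n₁, n₁ = (H + p.ρ₃ + 1) / p.κ := ⟨_, rfl⟩
  have hn₁' : n₁ * p.κ = H + p.ρ₃ + 1 := by rw [hn₁]; field_simp
  have hn₁p : 0 < n₁ := by rw [hn₁]; positivity
  obtain ⟨G, hG⟩ : ∃ G, G = n₁ * p.δ * M := ⟨_, rfl⟩
  obtain ⟨P, hP⟩ : ∃ P, P = n₁ * (p.τ₀ / p.ρ₃) * p.κ := ⟨_, rfl⟩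
  obtain ⟨Q, hQ⟩ : ∃ Q, Q = n₁ * (p.τ₀ / p.ρ₃) * p.γ := ⟨_, rfl⟩
  have hPp : 0 < P := by rw [hP]; positivity
  -- `R` collects the coefficients of `‖q‖²` that `n D₀` has to dominate.
  obtain ⟨R, hR⟩ : ∃ R, R = A ^ 2 / (4 * (p.ρ₂ / 4)) + G ^ 2 / (4 * 1) + P
    + Q ^ 2 / (4 * (p.ρ₂ / 4)) := ⟨_, rfl⟩
  have hRp : 0 < R := by rw [hR]; positivity
  refine ⟨n₁, n₂, hn₁p, hn₂p, fun n₀ => ⟨max n₀ (2 * p.ρ₁ / p.μ + (R + p.τ₀) / p.δ),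
    le_max_left _ _, ?_⟩⟩
  intro a d e s h g D₀ D₁ D₂ D₃ h0 h1 h2 h3
  set n := max n₀ (2 * p.ρ₁ / p.μ + (R + p.τ₀) / p.δ)
  have hn : 2 * p.ρ₁ / p.μ + (R + p.τ₀) / p.δ ≤ n := le_max_right _ _
  have hnμ : 2 * p.ρ₁ ≤ n * p.μ := by
    rw [← div_le_iff₀ hμ]
    have : 0 ≤ (R + p.τ₀) / p.δ := by positivity
    linarith
  have hnδ : R + p.τ₀ ≤ n * p.δ := by
    rw [← div_le_iff₀ hδ]
    have : 0 ≤ 2 * p.ρ₁ / p.μ := by positivity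
    linarith
  have y1 := mul_mul_le_sq_add (ε := p.b / 2) (by positivity) p.γ e h
  have y2 := mul_mul_le_sq_add (ε := p.ρ₂ / 4) (by positivity) A d g
  have y3 := mul_mul_le_sq_add (ε := p.b / 4) (by positivity) B e h
  have y4 := mul_mul_le_sq_add (ε := p.k / 4) (by positivity) C s h
  have y5 := mul_mul_le_sq_add (ε := 1) one_pos G h g
  have y6 := mul_mul_le_sq_add (ε := p.ρ₂ / 4) (by positivity) Q d g
  have z0 : n * D₀ ≤ -(2 * p.ρ₁) * a ^ 2 - (R + p.τ₀) * g ^ 2 := by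
    have u1 := mul_le_mul_of_nonneg_right hnμ (sq_nonneg a)
    have u2 := mul_le_mul_of_nonneg_right hnδ (sq_nonneg g)
    rw [h0]
    linarith
  have z1 : n₁ * D₁ ≤ P * g ^ 2 + Q * d * g + G * h * g - (H + p.ρ₃ + 1) * h ^ 2 := by
    have u1 := mul_le_mul_of_nonneg_left h1 hn₁p.le
    rw [← hn₁', hP, hQ, hG]
    linarith
  have z2 : n₂ * D₂ ≤ B * e * h + C * s * h + n₂ * p.ρ₃ * p.γ * h ^ 2 + A * d * g
      - 2 * p.ρ₂ * d ^ 2 := by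
    have u1 := mul_le_mul_of_nonneg_left h2 hn₂p.le
    rw [← hn₂', hA, hB, hC]
    linarith
  have e1 : H * h ^ 2 = p.γ ^ 2 / (4 * (p.b / 2)) * h ^ 2 + B ^ 2 / (4 * (p.b / 4)) * h ^ 2
      + C ^ 2 / (4 * (p.k / 4)) * h ^ 2 + n₂ * p.ρ₃ * p.γ * h ^ 2 := by
    rw [hH]
    ring
  have e2 : R * g ^ 2 = A ^ 2 / (4 * (p.ρ₂ / 4)) * g ^ 2 + G ^ 2 / (4 * 1) * g ^ 2 + P * g ^ 2
      + Q ^ 2 / (4 * (p.ρ₂ / 4)) * g ^ 2 := by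
    rw [hR]
    ring
  have w1 : 0 ≤ p.ρ₁ * a ^ 2 := by positivity
  have w2 : 0 ≤ p.ρ₂ * d ^ 2 := by positivity
  have w3 : 0 ≤ p.b * e ^ 2 := by positivity
  have w4 : 0 ≤ p.k * s ^ 2 := by positivity
  have w5 : 0 ≤ p.ρ₃ * h ^ 2 := by positivity
  have w6 : 0 ≤ p.τ₀ * g ^ 2 := by positivity
  linarith

lemma norm_le_sqrt {c x e : ℝ} (hc : 0 < c) (h : 1 / 2 * (c * x ^ 2) ≤ e) :
    x ≤ √(2 / c) * √e := by
  rw [← Real.sqrt_mul (by positivity)]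
  refine Real.le_sqrt_of_sq_le ?_
  rw [div_mul_eq_mul_div, le_div_iff₀ hc]
  linarith

/-- All components entering the multipliers are bounded by the square root of the energy. -/
lemma exists_norm_le (p : Params) (hL : 0 < p.L) (hρ₁ : 0 < p.ρ₁) (hρ₂ : 0 < p.ρ₂)
    (hρ₃ : 0 < p.ρ₃) (hb : 0 < p.b) (hk : 0 < p.k) (hτ₀ : 0 < p.τ₀)
    {J : L2 p.L →L[ℝ] L2 p.L} (hJ : ∀ f, (J f, meanFree p.L f) ∈ H10 p.L) :
    ∃ K : ℝ, 0 < K ∧ ∀ V : State p.L, ∀ r, r = √(normEnergy p V (meanFree p.L V.θ)) →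
      ‖V.φt‖ ≤ K * r ∧ ‖V.ψt‖ ≤ K * r ∧ ‖V.q‖ ≤ K * r ∧ ‖V.ψ‖ ≤ K * r ∧ ‖V.φ‖ ≤ K * r ∧
        ‖J V.θ‖ ≤ K * r := by
  obtain ⟨M, hM⟩ : ∃ M, M = 2 * p.L := ⟨_, rfl⟩
  have hMp : 0 < M := by rw [hM]; positivity
  obtain ⟨K, hK⟩ : ∃ K, K = √(2 / p.ρ₁) + √(2 / p.ρ₂) + √(2 / p.τ₀) + M * √(2 / p.b)
    + M * (√(2 / p.k) + M * √(2 / p.b)) + M * √(2 / p.ρ₃) := ⟨_, rfl⟩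
  have q1 : 0 < √(2 / p.ρ₁) := by positivity
  have q2 : 0 < √(2 / p.ρ₂) := by positivity
  have q3 : 0 < √(2 / p.τ₀) := by positivity
  have q4 : 0 < M * √(2 / p.b) := by positivity
  have q5 : 0 < M * (√(2 / p.k) + M * √(2 / p.b)) := by positivity
  have q6 : 0 < M * √(2 / p.ρ₃) := by positivity
  refine ⟨K, by rw [hK]; positivity, fun V r hr => ?_⟩
  have w1 : 0 ≤ p.ρ₁ * ‖V.φt‖ ^ 2 := by positivity
  have w2 : 0 ≤ p.ρ₂ * ‖V.ψt‖ ^ 2 := by positivity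
  have w3 : 0 ≤ p.b * ‖V.ψx‖ ^ 2 := by positivity
  have w4 : 0 ≤ p.k * ‖V.φx + V.ψ‖ ^ 2 := by positivity
  have w5 : 0 ≤ p.ρ₃ * ‖meanFree p.L V.θ‖ ^ 2 := by positivity
  have w6 : 0 ≤ p.τ₀ * ‖V.q‖ ^ 2 := by positivity
  have he : normEnergy p V (meanFree p.L V.θ) = 1 / 2 * (p.ρ₁ * ‖V.φt‖ ^ 2 + p.ρ₂ * ‖V.ψt‖ ^ 2
    + p.b * ‖V.ψx‖ ^ 2 + p.k * ‖V.φx + V.ψ‖ ^ 2 + p.ρ₃ * ‖meanFree p.L V.θ‖ ^ 2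
    + p.τ₀ * ‖V.q‖ ^ 2) := rfl
  have hr0 : 0 ≤ r := hr ▸ Real.sqrt_nonneg _
  have b1 : ‖V.φt‖ ≤ √(2 / p.ρ₁) * r := hr ▸ norm_le_sqrt hρ₁ (by linarith)
  have b2 : ‖V.ψt‖ ≤ √(2 / p.ρ₂) * r := hr ▸ norm_le_sqrt hρ₂ (by linarith)
  have b3 : ‖V.ψx‖ ≤ √(2 / p.b) * r := hr ▸ norm_le_sqrt hb (by linarith)
  have b4 : ‖V.φx + V.ψ‖ ≤ √(2 / p.k) * r :=
    hr ▸ norm_le_sqrt hk (by linarith)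
  have b5 : ‖meanFree p.L V.θ‖ ≤ √(2 / p.ρ₃) * r :=
    hr ▸ norm_le_sqrt hρ₃ (by linarith)
  have b6 : ‖V.q‖ ≤ √(2 / p.τ₀) * r := hr ▸ norm_le_sqrt hτ₀ (by linarith)
  have c1 : ‖V.ψ‖ ≤ M * ‖V.ψx‖ := hM ▸ poincare hL.le V.mem_H10_ψ
  have c2 : ‖V.φ‖ ≤ M * ‖V.φx‖ := hM ▸ poincare hL.le V.mem_H10_φ
  have c3 : ‖J V.θ‖ ≤ M * ‖meanFree p.L V.θ‖ := hM ▸ poincare hL.le (hJ V.θ)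
  have c4 : ‖V.φx‖ ≤ ‖V.φx + V.ψ‖ + ‖V.ψ‖ := by
    simpa using norm_sub_le (V.φx + V.ψ) V.ψ
  have b7 : ‖V.ψ‖ ≤ M * √(2 / p.b) * r := by
    refine c1.trans ?_
    rw [mul_assoc]
    gcongr
  have b8 : ‖V.φ‖ ≤ M * (√(2 / p.k) + M * √(2 / p.b)) * r := by
    refine c2.trans ?_
    rw [mul_assoc]
    gcongr
    linarith
  have b9 : ‖J V.θ‖ ≤ M * √(2 / p.ρ₃) * r := by
    refine c3.trans ?_
    rw [mul_assoc]
    gcongr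
  refine ⟨b1.trans ?_, b2.trans ?_, b6.trans ?_, b7.trans ?_, b8.trans ?_, b9.trans ?_⟩ <;>
  · refine mul_le_mul_of_nonneg_right ?_ hr0
    linarith

/-- The weighted sum of the three multiplier functionals. -/
def multiplierSum (p : Params) (J : L2 p.L →L[ℝ] L2 p.L) (n₁ n₂ : ℝ) (V : State p.L) : ℝ :=
  n₁ * (-p.τ₀ * inner ℝ V.q (J V.θ)) + n₂ * (p.ρ₂ * p.ρ₃ * inner ℝ (J V.θ) V.ψt)
    + (p.ρ₂ * inner ℝ V.ψt V.ψ + p.ρ₁ * inner ℝ V.φt V.φ + p.μ / 2 * ‖V.φ‖ ^ 2)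

lemma abs_inner_le {E : Type*} [NormedAddCommGroup E] [InnerProductSpace ℝ E] {x y : E} {c : ℝ}
    (hx : ‖x‖ ≤ c) (hy : ‖y‖ ≤ c) : |inner ℝ x y| ≤ c ^ 2 := by
  refine (abs_real_inner_le_norm x y).trans ?_
  rw [sq]
  exact mul_le_mul hx hy (norm_nonneg _) ((norm_nonneg _).trans hx)

lemma normEnergy_nonneg (p : Params) (hρ₁ : 0 < p.ρ₁) (hρ₂ : 0 < p.ρ₂) (hρ₃ : 0 < p.ρ₃)
    (hb : 0 < p.b) (hk : 0 < p.k) (hτ₀ : 0 < p.τ₀) (V : State p.L) (ϑ : L2 p.L) :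
    0 ≤ normEnergy p V ϑ := by
  unfold normEnergy
  positivity

/-- The multiplier functionals are dominated by the energy. -/
lemma exists_abs_multiplierSum_le (p : Params) (hL : 0 < p.L) (hρ₁ : 0 < p.ρ₁) (hρ₂ : 0 < p.ρ₂)
    (hρ₃ : 0 < p.ρ₃) (hb : 0 < p.b) (hk : 0 < p.k) (hτ₀ : 0 < p.τ₀) (hμ : 0 < p.μ)
    {J : L2 p.L →L[ℝ] L2 p.L} (hJ : ∀ f, (J f, meanFree p.L f) ∈ H10 p.L) {n₁ n₂ : ℝ}
    (hn₁ : 0 < n₁) (hn₂ : 0 < n₂) :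
    ∃ N : ℝ, 0 < N ∧ ∀ V : State p.L,
      |multiplierSum p J n₁ n₂ V| ≤ N * normEnergy p V (meanFree p.L V.θ) := by
  obtain ⟨K, hK, hb⟩ := exists_norm_le p hL hρ₁ hρ₂ hρ₃ hb hk hτ₀ hJ
  refine ⟨(n₁ * p.τ₀ + n₂ * (p.ρ₂ * p.ρ₃) + p.ρ₂ + p.ρ₁ + p.μ / 2) * K ^ 2, by positivity,
    fun V => ?_⟩
  obtain ⟨b1, b2, b3, b4, b5, b6⟩ := hb V _ rfl
  have hE : 0 ≤ normEnergy p V (meanFree p.L V.θ) :=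
    normEnergy_nonneg p hρ₁ hρ₂ hρ₃ ‹_› hk hτ₀ V _
  have hc : (K * √(normEnergy p V (meanFree p.L V.θ))) ^ 2
      = K ^ 2 * normEnergy p V (meanFree p.L V.θ) := by
    rw [mul_pow, Real.sq_sqrt hE]
  have i1 := abs_le.1 (abs_inner_le b3 b6)
  have i2 := abs_le.1 (abs_inner_le b6 b2)
  have i3 := abs_le.1 (abs_inner_le b2 b4)
  have i4 := abs_le.1 (abs_inner_le b1 b5)
  have i5 := abs_le.1 (abs_inner_le b5 b5)
  rw [real_inner_self_eq_norm_sq] at i5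
  rw [hc] at i1 i2 i3 i4 i5
  set S := K ^ 2 * normEnergy p V (meanFree p.L V.θ)
  have m1 : 0 < n₁ * p.τ₀ := by positivity
  have m2 : 0 < n₂ * (p.ρ₂ * p.ρ₃) := by positivity
  have m5 : 0 < p.μ / 2 := by positivity
  rw [mul_assoc, multiplierSum, abs_le]
  have u1 := mul_le_mul_of_nonneg_left i1.1 m1.le
  have u2 := mul_le_mul_of_nonneg_left i2.1 m2.le
  have u3 := mul_le_mul_of_nonneg_left i3.1 hρ₂.le
  have u4 := mul_le_mul_of_nonneg_left i4.1 hρ₁.le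
  have u5 := mul_le_mul_of_nonneg_left i5.1 m5.le
  have v1 := mul_le_mul_of_nonneg_left i1.2 m1.le
  have v2 := mul_le_mul_of_nonneg_left i2.2 m2.le
  have v3 := mul_le_mul_of_nonneg_left i3.2 hρ₂.le
  have v4 := mul_le_mul_of_nonneg_left i4.2 hρ₁.le
  have v5 := mul_le_mul_of_nonneg_left i5.2 m5.le
  constructor <;> linarith

/-- The mean temperature is conserved. -/
lemma IsClassicalSolution.inner_one_θ {p : Params} (hL : 0 ≤ p.L) (hρ₃ : 0 < p.ρ₃)
    {V : ℝ → State p.L} (hV : IsClassicalSolution p V) {t : ℝ} (ht : 0 ≤ t) :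
    inner ℝ (one p.L) (V t).θ = inner ℝ (one p.L) (V 0).θ := by
  obtain ⟨W, -, hW⟩ := hV
  have hd : ∀ r ∈ Ici (0 : ℝ), HasDerivWithinAt
      (fun r => inner ℝ (one p.L) (θL p.L (V r))) 0 (Ici 0) r := fun r hr => by
    refine ((hasDerivWithinAt_const r _ (one p.L)).inner ℝ
      (hasDerivWithinAt_clm (hW r hr).1 (θL p.L))).congr_deriv ?_
    rw [inner_zero_left, add_zero]
    exact ((hW r hr).2.isWeakRel hL).inner_one_θ hL hρ₃
  exact constant_of_has_deriv_right_zero (a := 0) (b := t)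
    (fun r hr => ((hd r hr.1).mono Icc_subset_Ici_self).continuousWithinAt)
    (fun r hr => (hd r hr.1).mono (Ici_subset_Ici.2 hr.1)) t ⟨ht, le_rfl⟩

lemma IsClassicalSolution.E_eq {p : Params} (hL : 0 ≤ p.L) (hρ₃ : 0 < p.ρ₃)
    {V : ℝ → State p.L} (hV : IsClassicalSolution p V) {t : ℝ} (ht : 0 ≤ t) :
    E p V t = normEnergy p (V t) (meanFree p.L (V t).θ) := by
  rw [E_eq_normEnergy, meanFree_apply, hV.inner_one_θ hL hρ₃ ht]

/-- Grönwall's inequality for a functional equivalent to the energy. -/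
lemma le_exp_of_deriv_le {e F F' : ℝ → ℝ} {c K₁ α : ℝ} (hα : 0 ≤ α)
    (hαc : α * K₁ ≤ c) (he : ∀ t, 0 ≤ t → 0 ≤ e t)
    (h1 : ∀ t, 0 ≤ t → e t ≤ F t) (h2 : ∀ t, 0 ≤ t → F t ≤ K₁ * e t)
    (hd : ∀ t, 0 ≤ t → HasDerivWithinAt F (F' t) (Ici 0) t)
    (hF' : ∀ t, 0 ≤ t → F' t ≤ -c * e t) {t : ℝ} (ht : 0 ≤ t) :
    e t ≤ K₁ * e 0 * Real.exp (-α * t) := by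
  have hder : ∀ r, 0 ≤ r → HasDerivWithinAt (fun r => F r * Real.exp (α * r))
      (F' r * Real.exp (α * r) + F r * (Real.exp (α * r) * α)) (Ici 0) r := fun r hr =>
    (hd r hr).mul (((hasDerivAt_id r).const_mul α).exp.hasDerivWithinAt.congr_deriv (by simp))
  have hanti : AntitoneOn (fun r => F r * Real.exp (α * r)) (Ici 0) := by
    refine antitoneOn_of_hasDerivWithinAt_nonpos (convex_Ici 0)
      (fun r hr => (hder r hr).continuousWithinAt)
      (fun r hr => (hder r (interior_subset hr)).mono interior_subset) fun r hr => ?_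
    have hr0 : 0 ≤ r := interior_subset hr
    have e1 : F' r + α * F r ≤ 0 := by
      have := mul_le_mul_of_nonneg_left (h2 r hr0) hα
      have := mul_le_mul_of_nonneg_right hαc (he r hr0)
      linarith [hF' r hr0]
    have := mul_nonpos_of_nonpos_of_nonneg e1 (Real.exp_pos (α * r)).le
    linarith
  have h3 := hanti (mem_Ici.2 le_rfl) (mem_Ici.2 ht) ht
  simp only [mul_zero, Real.exp_zero, mul_one] at h3
  rw [neg_mul, Real.exp_neg, ← div_eq_mul_inv, le_div_iff₀ (Real.exp_pos _)]
  exact (mul_le_mul_of_nonneg_right (h1 t ht) (Real.exp_pos _).le).trans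
    (h3.trans (h2 0 le_rfl))

/-- Exponential decay of classical solutions. The rate is a quarter of the inverse of the constant
comparing the Lyapunov functional to the energy, as `F' ≤ -E / 2` and the exponent is `-2 α t`. -/
theorem exists_decay_of_isClassicalSolution (p : Params)
    (hL : 0 < p.L) (hρ₁ : 0 < p.ρ₁) (hρ₂ : 0 < p.ρ₂) (hρ₃ : 0 < p.ρ₃)
    (hb : 0 < p.b) (hk : 0 < p.k) (hγ : 0 < p.γ) (hκ : 0 < p.κ) (hδ : 0 < p.δ)
    (hτ₀ : 0 < p.τ₀) (hμ : 0 < p.μ) :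
    ∃ C : ℝ, 0 < C ∧ ∃ α : ℝ, 0 < α ∧ ∀ V : ℝ → State p.L, IsClassicalSolution p V →
      ∀ t : ℝ, 0 ≤ t → E p V t ≤ C * E p V 0 * Real.exp (-2 * α * t) := by
  obtain ⟨J, hJ⟩ := exists_primitiveOperator hL
  obtain ⟨n₁, n₂, hn₁, hn₂, hn⟩ :=
    exists_weights p hρ₁ hρ₂ hρ₃ hb hk hγ hκ hδ hτ₀ hμ (2 * p.L)
  obtain ⟨N, hN, hNb⟩ :=
    exists_abs_multiplierSum_le p hL hρ₁ hρ₂ hρ₃ hb hk hτ₀ hμ hJ hn₁ hn₂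
  -- With `n ≥ N + 1` the functional dominates the energy.
  obtain ⟨n, hnN, hn⟩ := hn (N + 1)
  refine ⟨n + N, by linarith, 1 / (4 * (n + N)), one_div_pos.2 (by linarith),
    fun V hV t ht => ?_⟩
  rw [hV.E_eq hL.le hρ₃ ht, hV.E_eq hL.le hρ₃ le_rfl]
  have hsol := hV
  obtain ⟨W, -, hW⟩ := hsol
  have hrel : ∀ r, 0 ≤ r → IsWeakRel p (V r) (W r) := fun r hr => (hW r hr).2.isWeakRel hL.le
  have hder : ∀ r, 0 ≤ r → ∃ D, HasDerivWithinAt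
      (fun r => n * normEnergy p (V r) (meanFree p.L (V r).θ) + multiplierSum p J n₁ n₂ (V r))
      D (Ici 0) r ∧ D ≤ -(1 / 2) * normEnergy p (V r) (meanFree p.L (V r).θ) := by
    intro r hr
    have hVr := (hW r hr).1
    refine ⟨_, ((hasDerivWithinAt_normEnergy hL.le hρ₃ hVr (hrel r hr)).const_mul n).add
      ((((hasDerivWithinAt_inner_q hL.le hρ₃ hJ hVr (hrel r hr)).const_mul n₁).add
      ((hasDerivWithinAt_inner_ψt hL.le hρ₃ hJ hVr (hrel r hr)).const_mul n₂)).add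
      (hasDerivWithinAt_inner_φ_ψ hVr (hrel r hr))), ?_⟩
    have c1 := abs_le.1 (abs_real_inner_le_norm (V r).q (V r).ψt)
    have c2 := abs_le.1 (abs_real_inner_le_norm (V r).q (J (V r).θ))
    have c3 := abs_le.1 (abs_real_inner_le_norm (V r).ψx (meanFree p.L (V r).θ))
    have c4 := abs_le.1 (abs_real_inner_le_norm ((V r).φx + (V r).ψ) (J (V r).θ))
    have c5 := abs_le.1 (abs_real_inner_le_norm (meanFree p.L (V r).θ) (V r).ψx)
    have c6 : ‖J (V r).θ‖ ≤ 2 * p.L * ‖meanFree p.L (V r).θ‖ := poincare hL.le (hJ _)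
    have c7 := mul_le_mul_of_nonneg_left c6 (norm_nonneg (V r).q)
    have c8 := mul_le_mul_of_nonneg_left c6 (norm_nonneg ((V r).φx + (V r).ψ))
    refine hn _ _ _ _ _ _ _ _ _ _ rfl ?_ ?_ ?_
    · gcongr
      · exact c1.2
      · exact c2.2.trans c7
    · have u1 : p.b * -inner ℝ (V r).ψx (meanFree p.L (V r).θ)
          ≤ p.b * (‖(V r).ψx‖ * ‖meanFree p.L (V r).θ‖) := by
        gcongr
        linarith
      have u2 : p.k * -inner ℝ ((V r).φx + (V r).ψ) (J (V r).θ)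
          ≤ p.k * (‖(V r).φx + (V r).ψ‖ * (2 * p.L * ‖meanFree p.L (V r).θ‖)) := by
        gcongr
        linarith
      have u3 : p.κ * -inner ℝ (V r).q (V r).ψt ≤ p.κ * (‖(V r).q‖ * ‖(V r).ψt‖) := by
        gcongr
        linarith
      have v1 := mul_le_mul_of_nonneg_left (add_le_add u1 u2) hρ₃.le
      have v2 := mul_le_mul_of_nonneg_left u3 hρ₂.le
      linarith
    · gcongr
      exact c5.2
  choose! D hD hDle using hder
  have hen : ∀ r, 0 ≤ normEnergy p (V r) (meanFree p.L (V r).θ) := fun r =>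
    normEnergy_nonneg p hρ₁ hρ₂ hρ₃ hb hk hτ₀ _ _
  have hexp : -2 * (1 / (4 * (n + N))) * t = -(1 / (2 * (n + N))) * t := by
    field_simp
    norm_num
  rw [hexp]
  have hpos : 0 < n + N := by linarith
  refine le_exp_of_deriv_le (e := fun r => normEnergy p (V r) (meanFree p.L (V r).θ))
    (c := 1 / 2) (by positivity) ?_ (fun r _ => hen r) (fun r _ => ?_) (fun r _ => ?_)
    hD hDle ht
  · apply le_of_eq
    field_simp
  · have h1 := (abs_le.1 (hNb (V r))).1
    have h2 := mul_le_mul_of_nonneg_right hnN (hen r)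
    linarith
  · have h1 := (abs_le.1 (hNb (V r))).2
    linarith

open Filter Topology

/-! ### Mild solutions -/

lemma GeneratorRel.sub {p : Params} {V V' W W' : State p.L} (h : GeneratorRel p V W)
    (h' : GeneratorRel p V' W') : GeneratorRel p (V - V') (W - W') := by
  obtain ⟨φxx, ψxx, φtx, ψtx, θx, qx, hφt, hψt, hq, hφxx, hψxx, hθx, e1, e2, e3, e4, e5, e6⟩ := h
  obtain ⟨φxx', ψxx', φtx', ψtx', θx', qx', hφt', hψt', hq', hφxx', hψxx', hθx',
    e1', e2', e3', e4', e5', e6'⟩ := h'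
  have hsub : ∀ {u v u' v' : L2 p.L}, HasWeakDeriv p.L u v → HasWeakDeriv p.L u' v' →
      HasWeakDeriv p.L (u - u') (v - v') := fun {u v u' v'} hu hu' => by
    simpa [sub_eq_add_neg] using hu.add (hu'.smul (-1))
  refine ⟨φxx - φxx', ψxx - ψxx', φtx - φtx', ψtx - ψtx', θx - θx', qx - qx',
    (H10 p.L).sub_mem hφt hφt', (H10 p.L).sub_mem hψt hψt', (H10 p.L).sub_mem hq hq',
    hsub hφxx hφxx', hsub hψxx hψxx', hsub hθx hθx', congrArg₂ (· - ·) e1 e1', ?_,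
    congrArg₂ (· - ·) e3 e3', ?_, ?_, ?_⟩
  · change p.ρ₁ • (W.φt - W'.φt) - p.k • (φxx - φxx' + (V.ψx - V'.ψx))
      + p.μ • (V.φt - V'.φt) = 0
    linear_combination (norm := module) e2 - e2'
  · change p.ρ₂ • (W.ψt - W'.ψt) - p.b • (ψxx - ψxx')
      + p.k • ((V.φx - V'.φx) + (V.ψ - V'.ψ)) + p.γ • (θx - θx') = 0
    linear_combination (norm := module) e4 - e4'
  · change p.ρ₃ • (W.θ - W'.θ) + p.κ • (qx - qx') + p.γ • (ψtx - ψtx') = 0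
    linear_combination (norm := module) e5 - e5'
  · change p.τ₀ • (W.q - W'.q) + p.δ • (V.q - V'.q) + p.κ • (θx - θx') = 0
    linear_combination (norm := module) e6 - e6'

lemma GeneratorRel.smul {p : Params} {V W : State p.L} (h : GeneratorRel p V W) (c : ℝ) :
    GeneratorRel p (c • V) (c • W) := by
  obtain ⟨φxx, ψxx, φtx, ψtx, θx, qx, hφt, hψt, hq, hφxx, hψxx, hθx, e1, e2, e3, e4, e5, e6⟩ := h
  refine ⟨c • φxx, c • ψxx, c • φtx, c • ψtx, c • θx, c • qx,
    (H10 p.L).smul_mem c hφt, (H10 p.L).smul_mem c hψt, (H10 p.L).smul_mem c hq,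
    hφxx.smul c, hψxx.smul c, hθx.smul c, congrArg (c • ·) e1, ?_,
    congrArg (c • ·) e3, ?_, ?_, ?_⟩
  · change p.ρ₁ • c • W.φt - p.k • (c • φxx + c • V.ψx) + p.μ • c • V.φt = 0
    linear_combination (norm := module) c • e2
  · change p.ρ₂ • c • W.ψt - p.b • c • ψxx + p.k • (c • V.φx + c • V.ψ) + p.γ • c • θx = 0
    linear_combination (norm := module) c • e4
  · change p.ρ₃ • c • W.θ + p.κ • c • qx + p.γ • c • ψtx = 0
    linear_combination (norm := module) c • e5
  · change p.τ₀ • c • W.q + p.δ • c • V.q + p.κ • c • θx = 0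
    linear_combination (norm := module) c • e6

/-- A mild solution has a primitive that solves the integrated equation. -/
lemma IsMildSolution.exists_primitive {p : Params} {V : ℝ → State p.L}
    (hV : IsMildSolution p V) : ∃ U : ℝ → State p.L, ∀ t, 0 ≤ t →
      HasDerivAt U (V t) t ∧ GeneratorRel p (U t) (V t - V 0) := by
  -- Extending `V` by `V 0` to negative times makes the integrand continuous.
  have hc : Continuous fun s => V (max s 0) :=
    hV.1.comp_continuous (continuous_id.max continuous_const) fun s => le_max_right s 0
  refine ⟨fun t => ∫ s in (0 : ℝ)..t, V (max s 0), fun t ht => ⟨?_, ?_⟩⟩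
  · have := (hc.integral_hasStrictDerivAt 0 t).hasDerivAt
    rwa [max_eq_left ht] at this
  · have he : ∫ s in (0 : ℝ)..t, V (max s 0) = ∫ s in (0 : ℝ)..t, V s := by
      refine intervalIntegral.integral_congr fun s hs => ?_
      rw [uIcc_of_le ht] at hs
      simp only [max_eq_left hs.1]
    have := hV.2 t ht
    rwa [← he] at this

/-- Averages of a mild solution over time intervals of length `h` are classical solutions. -/
lemma isClassicalSolution_average {p : Params} {V U : ℝ → State p.L}
    (hc : ContinuousOn V (Ici 0))
    (hU : ∀ t, 0 ≤ t → HasDerivAt U (V t) t ∧ GeneratorRel p (U t) (V t - V 0))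
    {h : ℝ} (hh : 0 < h) : IsClassicalSolution p fun t => h⁻¹ • (U (t + h) - U t) := by
  refine ⟨fun t => h⁻¹ • (V (t + h) - V t), ?_, fun t ht => ⟨?_, ?_⟩⟩
  · have h1 : ContinuousOn (fun t => V (t + h)) (Ici 0) :=
      hc.comp (by fun_prop) fun t ht => add_nonneg (mem_Ici.1 ht) hh.le
    exact (h1.sub hc).const_smul h⁻¹
  · have h1 : HasDerivAt (fun r => U (r + h)) (V (t + h)) t :=
      (hU (t + h) (by linarith)).1.comp_add_const t h
    exact ((h1.fun_sub (hU t ht).1).fun_const_smul h⁻¹).hasDerivWithinAt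
  · have := ((hU (t + h) (by linarith)).2.sub (hU t ht).2).smul h⁻¹
    rwa [sub_sub_sub_cancel_right] at this

/-- The energy at time `t` depends continuously on the states at times `t` and `0`. -/
lemma tendsto_E {p : Params} {ι : Type*} {l : Filter ι} {Vn : ι → ℝ → State p.L}
    {V : ℝ → State p.L} {t : ℝ} (ht : Tendsto (fun i => Vn i t) l (𝓝 (V t)))
    (h0 : Tendsto (fun i => Vn i 0) l (𝓝 (V 0))) :
    Tendsto (fun i => E p (Vn i) t) l (𝓝 (E p V t)) := by
  simp only [E_eq_normEnergy]
  have hθ : Continuous fun V : State p.L => V.θ := (State.θL p.L).continuous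
  have hcont : Continuous fun w : State p.L × State p.L =>
      normEnergy p w.1 (w.1.θ - (p.L⁻¹ * inner ℝ (one p.L) w.2.θ) • one p.L) := by
    have h1 : Continuous fun w : State p.L × State p.L => w.1.θ := hθ.comp continuous_fst
    have h2 : Continuous fun w : State p.L × State p.L => w.2.θ := hθ.comp continuous_snd
    have h3 : Continuous fun w : State p.L × State p.L =>
        (p.L⁻¹ * inner ℝ (one p.L) w.2.θ) • one p.L := by fun_prop
    have h4 : Continuous fun w : State p.L × State p.L =>
        w.1.θ - (p.L⁻¹ * inner ℝ (one p.L) w.2.θ) • one p.L := h1.sub h3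
    exact continuous_normEnergy p continuous_fst h4
  have h5 : Tendsto (fun i => (Vn i t, Vn i 0)) l (𝓝 (V t, V 0)) := ht.prodMk_nhds h0
  have h6 := (hcont.tendsto (V t, V 0)).comp h5
  simp only [Function.comp_def] at h6
  exact h6

end Timoshenko

end

theorem mainTheorem2 (p : Timoshenko.Params)
    (hL : 0 < p.L) (hρ₁ : 0 < p.ρ₁) (hρ₂ : 0 < p.ρ₂) (hρ₃ : 0 < p.ρ₃)
    (hb : 0 < p.b) (hk : 0 < p.k) (hγ : 0 < p.γ) (hκ : 0 < p.κ) (hδ : 0 < p.δ)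
    (hτ₀ : 0 < p.τ₀) (hμ : 0 < p.μ) :
    ∃ C : ℝ, 0 < C ∧ ∃ α : ℝ, 0 < α ∧
      (∀ V : ℝ → Timoshenko.State p.L, Timoshenko.IsClassicalSolution p V →
        ∀ t : ℝ, 0 ≤ t →
          Timoshenko.E p V t ≤ C * Timoshenko.E p V 0 * Real.exp (-2 * α * t)) ∧
      (∀ V : ℝ → Timoshenko.State p.L, Timoshenko.IsMildSolution p V →
        ∀ t : ℝ, 0 ≤ t →
          Timoshenko.E p V t ≤ C * Timoshenko.E p V 0 * Real.exp (-2 * α * t)) := by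
  obtain ⟨C, hC, α, hα, h⟩ := Timoshenko.exists_decay_of_isClassicalSolution p hL hρ₁ hρ₂ hρ₃
    hb hk hγ hκ hδ hτ₀ hμ
  refine ⟨C, hC, α, hα, h, fun V hV t ht => ?_⟩
  obtain ⟨U, hU⟩ := hV.exists_primitive
  -- The estimate for the averages of `V` passes to the limit.
  have hlim : ∀ r, 0 ≤ r → Filter.Tendsto (fun ε : ℝ => ε⁻¹ • (U (r + ε) - U r))
      (nhdsWithin 0 (Ioi 0)) (nhds (V r)) := fun r hr => (hU r hr).1.tendsto_slope_zero_right
  have hE : ∀ r, 0 ≤ r → Filter.Tendsto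
      (fun ε : ℝ => Timoshenko.E p (fun r => ε⁻¹ • (U (r + ε) - U r)) r)
      (nhdsWithin 0 (Ioi 0)) (nhds (Timoshenko.E p V r)) := fun r hr =>
    Timoshenko.tendsto_E (hlim r hr) (hlim 0 le_rfl)
  refine le_of_tendsto_of_tendsto (hE t ht) (((hE 0 le_rfl).const_mul C).mul_const _) ?_
  filter_upwards [self_mem_nhdsWithin] with ε hε
  exact h _ (Timoshenko.isClassicalSolution_average hV.1 hU hε) t ht
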